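/- Consider the heteroscedastic AR(1) model $X_t=\theta_0X_{t-1}+Z_t$, $Z_t=\tau_t\epsilon_t$, $t\ge 1$, where $|\theta_0|<1$, the $\tau_t>0$ are constants, the $\epsilon_t$ are i.i.d. with mean $0$ and variance $1$, each $\epsilon_t$ is independent of $(X_0,\dots,X_{t-1})$, and all moments of $X_0$ are finite. Let $$\hat\theta_2=\frac{\sum_{t=2}^nX_tX_{t-1}}{\sum_{t=2}^nX_{t-1}^2}$$ be the ordinary least-squares estimator based on $X_1,\dots,X_n$, and let $s_n\ge 0$ be defined by $s_n^2=\sum_{t=2}^n\tau_t^2\,E(X_{t-1}^2)$. Suppose that (A1) there are constants $0<M_1\le M_2$ with $M_1\le\tau_t\le M_2$ for all $t\ge1$; (A2) $\frac1n\sum_{t=1}^n\tau_t^2\to\tau^2$ as $n\to\infty$, with $\tau^2>0$. Then, as $n\to\infty$, $$\Big(\frac{s_n}{\sqrt n}\Big)^{-1}\sqrt n\,(\hat\theta_2-\theta_0)\xrightarrow{d}N\Big(0,\frac{(1-\theta_0^2)^2}{\tau^4}\Big).$$ If, further, $\theta_0\ne0$ and (A3) $\frac1n\sum_{1\le i<j\le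 n}\tau_i^2\tau_j^2\theta_0^{2(j-i)}\to\rho^2$ as $n\to\infty$, then $$\sqrt n\,(\hat\theta_2-\theta_0)\xrightarrow{d}N\Big(0,\frac{\rho^2(1-\theta_0^2)^2}{\tau^4\theta_0^2}\Big).$$ -/

import Mathlib

open MeasureTheory ProbabilityTheory Filter Topology

noncomputable section

/-- The heteroscedastic AR(1) model: `X_t = θ₀ X_{t-1} + Z_t`, `Z_t = τ_t ε_t` for `t ≥ 1`, with
`|θ₀| < 1`, constants `τ_t > 0`, i.i.d. errors `ε_t` (`t ≥ 1`) of mean `0` and variance `1`, each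
`ε_t` independent of the past `(X_0, …, X_{t-1})`, and an initial value `X_0` all of whose moments
are finite. The values `τ 0` and `ε 0` play no role. -/
structure IsHeteroscedasticAR1 {Ω : Type*} [MeasurableSpace Ω] (P : Measure Ω)
    (θ₀ : ℝ) (τ : ℕ → ℝ) (ε X : ℕ → Ω → ℝ) : Prop where
  abs_lt_one : |θ₀| < 1
  scale_pos : ∀ t, 1 ≤ t → 0 < τ t
  measurable_error : ∀ t, 1 ≤ t → Measurable (ε t)
  iIndepFun_error : iIndepFun (fun t : ℕ => ε (t + 1)) P
  identDistrib_error : ∀ s t, 1 ≤ s → 1 ≤ t → IdentDistrib (ε s) (ε t) P P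
  memLp_error : ∀ t, 1 ≤ t → MemLp (ε t) 2 P
  mean_error : ∀ t, 1 ≤ t → ∫ ω, ε t ω ∂P = 0
  variance_error : ∀ t, 1 ≤ t → variance (ε t) P = 1
  indep_past : ∀ t, 1 ≤ t → IndepFun (ε t) (fun ω (s : Fin t) => X s ω) P
  measurable_init : Measurable (X 0)
  moments_init : ∀ p : ℕ, MemLp (X 0) p P
  recursion : ∀ t, 1 ≤ t → ∀ ω, X t ω = θ₀ * X (t - 1) ω + τ t * ε t ω

/-- The ordinary least squares estimator
`θ̂₂ = (∑_{t=2}^n X_t X_{t-1}) / (∑_{t=2}^n X_{t-1}²)` from the observations `X_1, …, X_n`. -/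
def olsEstimator {Ω : Type*} (X : ℕ → Ω → ℝ) (n : ℕ) (ω : Ω) : ℝ :=
  (∑ t ∈ Finset.Icc 2 n, X t ω * X (t - 1) ω) / ∑ t ∈ Finset.Icc 2 n, X (t - 1) ω ^ 2

/-- The nonnegative number `s_n` with `s_n² = ∑_{t=2}^n τ_t² E(X_{t-1}²)`. -/
def scoreScale {Ω : Type*} [MeasurableSpace Ω] (P : Measure Ω) (τ : ℕ → ℝ) (X : ℕ → Ω → ℝ)
    (n : ℕ) : ℝ :=
  √(∑ t ∈ Finset.Icc 2 n, τ t ^ 2 * ∫ ω, X (t - 1) ω ^ 2 ∂P)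

/-- Convergence in distribution of `Y_n` to the centred normal law `N(0, v)`, where `v ≥ 0`. -/
def TendstoNormal {Ω : Type*} [MeasurableSpace Ω] (P : Measure Ω) [IsProbabilityMeasure P]
    (Y : ℕ → Ω → ℝ) (v : ℝ) : Prop :=
  TendstoInDistribution Y atTop (id : ℝ → ℝ) (fun _ => P) (gaussianReal 0 v.toNNReal)

end

/-! Since `X t = θ₀ X (t-1) + Z t`, the error of the estimator is the score `∑ X (t-1) Z t` divided
by `∑ X (t-1)²`. With respect to the filtration of the observations the score is a martingale.
Divided by `sₙ` it becomes `∑ aₙₖ ε (k+1)` with `aₙₖ` known at time `k`, and three limits give the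
theorem.

The normalized score tends to `N(0,1)` (`tendstoInDistribution_sum_predictable_mul`). With `S` the
score and `A` its conditional variance, each step multiplies `exp(iuS + u²A/2)` by a factor of
conditional mean `1 + o(a²)`. Its expectation therefore stays near `1`, and when `A` is close to `1`
this says `E exp(iuS) ≈ exp(-u²/2)`. Truncating the multipliers keeps the exponential bounded. The
hypotheses are `∑ aₙₖ² → 1` and `maxₖ |aₙₖ| → 0` in probability.

Both `∑ aₙₖ² → 1` and the limit `τ²/(1-θ₀²)` of `n⁻¹ ∑ X (t-1)²` come from one weak law for weighted
sums of `X k² - E X k²` (`tendsto_integral_abs_sum_sq_sub_div`). The centred squares obey a linear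
recursion driven by martingale differences, and summation by parts turns the weighted sum into a sum
over innovations. No fourth moment of `ε` is available, so the part in `ε² - 1` is treated by `L¹`
approximation with bounded functions. Slutsky's theorem then gives the first claim.

For the second claim, unrolling the recursion of `E X k²` shows that `θ₀² sₙ²` is the double sum of
(A3) plus a bounded contribution of `X 0`, so `sₙ/√n → |ρ|/|θ₀|`. -/

/-! ### Compensated exponentials of sums with predictable multipliers -/

section MartingaleCLT

variable {Ω : Type*} {m mΩ : MeasurableSpace Ω} {P : Measure Ω}

theorem indepFun_of_measurable_of_indep {β : Type*} [MeasurableSpace β]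
    {f : Ω → β} {e : Ω → ℝ} (hf : Measurable[m] f)
    (hind : Indep (MeasurableSpace.comap e inferInstance) m P) : IndepFun f e P := by
  rw [IndepFun_iff_Indep]
  exact (indep_of_indep_of_le_right hind hf.comap_le).symm

/-- Integrating out `e` while the past is frozen: independence makes the joint law of `(M, a)` and
`e` a product, and Fubini does the rest. This replaces conditional expectations throughout. -/
theorem integral_mul_exp_eq_integral_mul_charFun [IsProbabilityMeasure P]
    (hm : m ≤ mΩ) {M : Ω → ℂ} {a e : Ω → ℝ} (hM : Measurable[m] M) (ha : Measurable[m] a)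
    (he : Measurable e) (hind : Indep (MeasurableSpace.comap e inferInstance) m P)
    {C : ℝ} (hC : ∀ ω, ‖M ω‖ ≤ C) (u : ℝ) :
    ∫ ω, M ω * Complex.exp (Complex.I * (u * (a ω * e ω) : ℝ)) ∂P =
      ∫ ω, M ω * charFun (P.map e) (u * a ω) ∂P := by
  have hpair : Measurable[m] (fun ω => (M ω, a ω)) := hM.prodMk ha
  have hpair' : Measurable (fun ω => (M ω, a ω)) := hpair.mono hm le_rfl
  have hI := indepFun_of_measurable_of_indep hpair hind
  have hmap := (indepFun_iff_map_prod_eq_prod_map_map hpair'.aemeasurable he.aemeasurable).1 hI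
  have : IsProbabilityMeasure (P.map e) := Measure.isProbabilityMeasure_map he.aemeasurable
  have : IsProbabilityMeasure (P.map (fun ω => (M ω, a ω))) :=
    Measure.isProbabilityMeasure_map hpair'.aemeasurable
  let G : (ℂ × ℝ) × ℝ → ℂ := fun z => z.1.1 * Complex.exp (Complex.I * (u * (z.1.2 * z.2) : ℝ))
  have hG : Measurable G := by unfold G; fun_prop
  have hnorm : ∀ z, ‖G z‖ = ‖z.1.1‖ := fun z => by
    simp only [G, norm_mul, mul_comm Complex.I, Complex.norm_exp_ofReal_mul_I, mul_one]
  have hGint : Integrable G ((P.map (fun ω => (M ω, a ω))).prod (P.map e)) := by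
    rw [← hmap]
    rw [integrable_map_measure hG.aestronglyMeasurable (hpair'.prodMk he).aemeasurable]
    exact Integrable.of_bound (hG.comp (hpair'.prodMk he)).aestronglyMeasurable C
      (ae_of_all _ fun ω => by simpa [hnorm] using hC ω)
  calc ∫ ω, M ω * Complex.exp (Complex.I * (u * (a ω * e ω) : ℝ)) ∂P
      = ∫ ω, G ((M ω, a ω), e ω) ∂P := rfl
    _ = ∫ z, G z ∂(P.map fun ω => ((M ω, a ω), e ω)) :=
        (integral_map (hpair'.prodMk he).aemeasurable hG.aestronglyMeasurable).symm
    _ = ∫ y, ∫ x, G (y, x) ∂(P.map e) ∂(P.map fun ω => (M ω, a ω)) := by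
        rw [hmap, integral_prod _ hGint]
    _ = ∫ y, y.1 * charFun (P.map e) (u * y.2) ∂(P.map fun ω => (M ω, a ω)) := by
        congr 1; ext y
        simp only [G, integral_const_mul, charFun_apply_real]
        congr 2; ext x; congr 1; push_cast; ring
    _ = ∫ ω, M ω * charFun (P.map e) (u * a ω) ∂P := by
        refine integral_map (φ := fun ω => (M ω, a ω))
          (f := fun y : ℂ × ℝ => y.1 * charFun (P.map e) (u * y.2)) hpair'.aemeasurable ?_
        have : Measurable (charFun (P.map e)) := measurable_charFun
        exact Measurable.aestronglyMeasurable (by fun_prop)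

/-- The exponential `exp(iu Sₖ + u² Aₖ / 2)` with `Sₖ = ∑ aⱼ eⱼ` and `Aₖ = ∑ aⱼ²`. -/
noncomputable def compensatedExp (u : ℝ) (a e : ℕ → Ω → ℝ) (k : ℕ) (ω : Ω) : ℂ :=
  Complex.exp (Complex.I * (u * ∑ j ∈ Finset.range k, a j ω * e j ω : ℝ)) *
    (Real.exp (u ^ 2 * (∑ j ∈ Finset.range k, a j ω ^ 2) / 2) : ℝ)

theorem norm_compensatedExp (u : ℝ) (a e : ℕ → Ω → ℝ) (k : ℕ) (ω : Ω) :
    ‖compensatedExp u a e k ω‖ = Real.exp (u ^ 2 * (∑ j ∈ Finset.range k, a j ω ^ 2) / 2) := by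
  rw [compensatedExp, norm_mul, mul_comm Complex.I, Complex.norm_exp_ofReal_mul_I, one_mul,
    Complex.norm_real, Real.norm_of_nonneg (Real.exp_pos _).le]

variable {ℱ : Filtration ℕ mΩ} {e a : ℕ → Ω → ℝ}

theorem measurable_compensatedExp {n : ℕ} (he : ∀ k, Measurable[ℱ (k + 1)] (e k))
    (ha : ∀ k < n, Measurable[ℱ k] (a k)) (u : ℝ) {k : ℕ} (hk : k ≤ n) :
    Measurable[ℱ k] (compensatedExp u a e k) := by
  have h1 : Measurable[ℱ k] fun ω => ∑ j ∈ Finset.range k, a j ω * e j ω := by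
    refine Finset.measurable_fun_sum _ fun j hj => ?_
    rw [Finset.mem_range] at hj
    exact ((ha j (by omega)).mono (ℱ.mono hj.le) le_rfl).mul ((he j).mono (ℱ.mono hj) le_rfl)
  have h2 : Measurable[ℱ k] fun ω => ∑ j ∈ Finset.range k, a j ω ^ 2 := by
    refine Finset.measurable_fun_sum _ fun j hj => ?_
    rw [Finset.mem_range] at hj
    exact ((ha j (by omega)).mono (ℱ.mono hj.le) le_rfl).pow_const 2
  have h3 : Measurable fun z : ℝ × ℝ => Complex.exp (Complex.I * (u * z.1 : ℝ)) *
      (Real.exp (u ^ 2 * z.2 / 2) : ℝ) := by fun_prop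
  have h4 := h3.comp (h1.prodMk h2)
  unfold compensatedExp
  simp only [Function.comp_def] at h4
  exact h4

/-- The expectation moves little at each step. Integrating out `e k` multiplies the integrand by
`exp(u²aₖ²/2) φ(u aₖ)`, which differs from `1` only through the gap between `φ` and the Gaussian
characteristic function. The cap `∑ aⱼ² ≤ 2` bounds every exponential by `exp(u²)`, so step `k`
costs at most `exp(u²) η E aₖ²`, and these costs add up to at most `2 η exp(u²)`. -/
theorem norm_integral_compensatedExp_sub_one_le [IsProbabilityMeasure P] {n : ℕ}
    (he : ∀ k, Measurable[ℱ (k + 1)] (e k))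
    (hind : ∀ k, Indep (MeasurableSpace.comap (e k) inferInstance) (ℱ k) P)
    {μ : Measure ℝ} (hlaw : ∀ k, P.map (e k) = μ) (ha : ∀ k < n, Measurable[ℱ k] (a k))
    (hA : ∀ ω, ∑ j ∈ Finset.range n, a j ω ^ 2 ≤ 2) {u η : ℝ} (hη : 0 ≤ η)
    (hφ : ∀ k < n, ∀ ω, ‖charFun μ (u * a k ω) - Real.exp (-(u ^ 2 * a k ω ^ 2 / 2))‖
      ≤ η * a k ω ^ 2) :
    ‖∫ ω, compensatedExp u a e n ω ∂P - 1‖ ≤ 2 * η * Real.exp (u ^ 2) := by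
  have hA' : ∀ k ≤ n, ∀ ω, ∑ j ∈ Finset.range k, a j ω ^ 2 ≤ 2 := fun k hk ω =>
    (Finset.sum_le_sum_of_subset_of_nonneg (Finset.range_mono hk)
      fun _ _ _ => sq_nonneg _).trans (hA ω)
  have hexp : ∀ k ≤ n, ∀ ω, Real.exp (u ^ 2 * (∑ j ∈ Finset.range k, a j ω ^ 2) / 2)
      ≤ Real.exp (u ^ 2) := fun k hk ω => by
    refine Real.exp_le_exp.2 ?_
    nlinarith [hA' k hk ω, sq_nonneg u]
  have hmeas : ∀ k < n, Measurable (a k) := fun k hk => (ha k hk).mono (ℱ.le k) le_rfl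
  have hsq : ∀ k < n, ∀ ω, a k ω ^ 2 ≤ 2 := fun k hk ω =>
    (Finset.single_le_sum (f := fun j => a j ω ^ 2) (fun _ _ => sq_nonneg _)
      (Finset.mem_range.2 hk)).trans (hA ω)
  have hint : ∀ k < n, Integrable (fun ω => a k ω ^ 2) P := fun k hk =>
    Integrable.of_bound ((hmeas k hk).pow_const 2).aestronglyMeasurable 2
      (ae_of_all _ fun ω => by
        rw [Real.norm_of_nonneg (sq_nonneg _)]; exact hsq k hk ω)
  have hMint : ∀ k ≤ n, Integrable (compensatedExp u a e k) P := fun k hk =>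
    Integrable.of_bound
      ((measurable_compensatedExp he ha u hk).mono (ℱ.le k) le_rfl).aestronglyMeasurable
      (Real.exp (u ^ 2)) (ae_of_all _ fun ω => by
        rw [norm_compensatedExp]; exact hexp k hk ω)
  have hφm : Measurable (charFun μ) := by
    rw [← hlaw 0]
    have : IsProbabilityMeasure (P.map (e 0)) :=
      Measure.isProbabilityMeasure_map ((he 0).mono (ℱ.le _) le_rfl).aemeasurable
    exact measurable_charFun
  have key : ∀ k ≤ n, ‖∫ ω, compensatedExp u a e k ω ∂P - 1‖ ≤
      Real.exp (u ^ 2) * η * ∑ j ∈ Finset.range k, ∫ ω, a j ω ^ 2 ∂P := by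
    intro k
    induction k with
    | zero => intro _; simp [compensatedExp]
    | succ k ih =>
      intro hk
      have ih := ih (by omega)
      set w : Ω → ℝ := fun ω => Real.exp (u ^ 2 * a k ω ^ 2 / 2)
      have hwm : Measurable[ℱ k] w :=
        (by fun_prop : Measurable fun x : ℝ => Real.exp (u ^ 2 * x ^ 2 / 2)).comp (ha k (by omega))
      have hsucc : ∀ ω, compensatedExp u a e (k + 1) ω = (compensatedExp u a e k ω * (w ω : ℝ)) *
          Complex.exp (Complex.I * (u * (a k ω * e k ω) : ℝ)) := by
        intro ω
        simp only [compensatedExp, w, Finset.sum_range_succ, mul_add, add_div, Real.exp_add,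
          Complex.ofReal_add, Complex.exp_add, Complex.ofReal_mul]
        ring
      have hnormw : ∀ ω, ‖compensatedExp u a e k ω * (w ω : ℝ)‖ =
          Real.exp (u ^ 2 * (∑ j ∈ Finset.range (k + 1), a j ω ^ 2) / 2) := by
        intro ω
        rw [norm_mul, norm_compensatedExp, Complex.norm_real, Real.norm_of_nonneg
          (Real.exp_pos _).le, ← Real.exp_add, Finset.sum_range_succ]
        congr 1; ring
      have hMw : Measurable[ℱ k] fun ω => compensatedExp u a e k ω * (w ω : ℝ) :=
        (measurable_compensatedExp he ha u (by omega)).mul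
          (Complex.measurable_ofReal.comp hwm)
      have hstep : ∫ ω, compensatedExp u a e (k + 1) ω ∂P =
          ∫ ω, compensatedExp u a e k ω * (w ω : ℝ) * charFun μ (u * a k ω) ∂P := by
        simp_rw [hsucc]
        rw [← hlaw k]
        exact integral_mul_exp_eq_integral_mul_charFun (ℱ.le k) hMw (ha k (by omega))
          ((he k).mono (ℱ.le (k + 1)) le_rfl) (hind k) (C := Real.exp (u ^ 2))
          (fun ω => by rw [hnormw]; exact hexp _ hk ω) u
      have hpt : ∀ ω, ‖compensatedExp u a e k ω * (w ω : ℝ) * charFun μ (u * a k ω) -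
          compensatedExp u a e k ω‖ ≤ Real.exp (u ^ 2) * η * a k ω ^ 2 := by
        intro ω
        have h1 : compensatedExp u a e k ω * (w ω : ℝ) * charFun μ (u * a k ω) -
            compensatedExp u a e k ω = compensatedExp u a e k ω * (w ω : ℝ) *
            (charFun μ (u * a k ω) - Real.exp (-(u ^ 2 * a k ω ^ 2 / 2))) := by
          have h2 : ((w ω : ℝ) : ℂ) * (Real.exp (-(u ^ 2 * a k ω ^ 2 / 2)) : ℝ) = 1 := by
            rw [← Complex.ofReal_mul, ← Real.exp_add, add_neg_cancel, Real.exp_zero,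
              Complex.ofReal_one]
          rw [mul_sub, mul_assoc _ (w ω : ℂ) (Real.exp _ : ℂ), h2, mul_one]
        rw [h1, norm_mul, hnormw, mul_assoc]
        exact mul_le_mul (hexp _ hk ω) (hφ k (by omega) ω) (norm_nonneg _) (Real.exp_pos _).le
      have hint2 : Integrable (fun ω => compensatedExp u a e k ω * (w ω : ℝ) *
          charFun μ (u * a k ω)) P := by
        have hm : Measurable fun ω => compensatedExp u a e k ω * (w ω : ℝ) *
            charFun μ (u * a k ω) - compensatedExp u a e k ω :=
          (((hMw.mono (ℱ.le k) le_rfl)).mul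
            (hφm.comp ((hmeas k (by omega)).const_mul u))).sub
            ((measurable_compensatedExp he ha u (by omega)).mono (ℱ.le k) le_rfl)
        have := (((hint k (by omega)).const_mul (Real.exp (u ^ 2) * η)).mono'
          hm.aestronglyMeasurable (ae_of_all _ hpt)).add (hMint k (by omega))
        exact this.congr (ae_of_all _ fun ω => sub_add_cancel _ _)
      have hdiff : ‖∫ ω, compensatedExp u a e (k + 1) ω ∂P - ∫ ω, compensatedExp u a e k ω ∂P‖
          ≤ Real.exp (u ^ 2) * η * ∫ ω, a k ω ^ 2 ∂P := by
        rw [hstep, ← integral_sub hint2 (hMint k (by omega)), ← integral_const_mul]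
        exact norm_integral_le_of_norm_le ((hint k (by omega)).const_mul _) (ae_of_all _ hpt)
      rw [Finset.sum_range_succ, mul_add]
      calc _ = ‖(∫ ω, compensatedExp u a e k ω ∂P - 1) + (∫ ω, compensatedExp u a e (k + 1) ω ∂P
            - ∫ ω, compensatedExp u a e k ω ∂P)‖ := by congr 1; ring
        _ ≤ _ := (norm_add_le _ _).trans (add_le_add ih hdiff)
  refine (key n le_rfl).trans ?_
  rw [← integral_finsetSum _ fun j hj => hint j (Finset.mem_range.1 hj)]
  have : ∫ ω, ∑ j ∈ Finset.range n, a j ω ^ 2 ∂P ≤ 2 := by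
    have := integral_mono (μ := P) (integrable_finsetSum (Finset.range n) fun j hj =>
      hint j (Finset.mem_range.1 hj)) (integrable_const (2 : ℝ)) hA
    simpa using this
  nlinarith [mul_nonneg (Real.exp_pos (u ^ 2)).le hη]

end MartingaleCLT

/-! ### Truncation and the martingale central limit theorem -/

section MartingaleCLT

variable {Ω : Type*} {mΩ : MeasurableSpace Ω} {P : Measure Ω} {ℱ : Filtration ℕ mΩ}
  {e : ℕ → Ω → ℝ}

theorem exists_norm_charFun_sub_exp_le [IsProbabilityMeasure P] {ε : Ω → ℝ}
    (hε : AEMeasurable ε P) (h0 : ∫ ω, ε ω ∂P = 0) (h1 : ∫ ω, ε ω ^ 2 ∂P = 1) {η : ℝ}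
    (hη : 0 < η) :
    ∃ δ > 0, ∀ v : ℝ, |v| ≤ δ →
      ‖charFun (P.map ε) v - Real.exp (-(v ^ 2 / 2))‖ ≤ η * v ^ 2 := by
  have ht := (taylor_charFun_two hε h0 (by simpa using h1)).def (half_pos hη)
  obtain ⟨r, hr, hball⟩ := Metric.eventually_nhds_iff.1 ht
  -- `r / 2` puts `v` strictly inside the Taylor ball; `1` gives `v² ≤ |v|`; together with `η` this
  -- makes the error `v⁴/4` of the exponential at most `(η/2) v²`.
  refine ⟨min (r / 2) (min 1 η), by positivity, fun v hv => ?_⟩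
  obtain ⟨hv1, hv2⟩ := le_min_iff.1 hv
  obtain ⟨hv2, hv3⟩ := le_min_iff.1 hv2
  have hA := hball (y := v) (by rw [Real.dist_eq, sub_zero]; linarith)
  rw [Real.norm_of_nonneg (sq_nonneg v)] at hA
  have hsq : v ^ 2 ≤ |v| := by rw [← sq_abs]; nlinarith [abs_nonneg v]
  have hB : ‖((Real.exp (-(v ^ 2 / 2)) : ℝ) : ℂ) - (1 - (v : ℂ) ^ 2 / 2)‖ ≤ η / 2 * v ^ 2 := by
    have h := Real.abs_exp_sub_one_sub_id_le (x := -(v ^ 2 / 2))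
      (by rw [abs_neg, abs_of_nonneg (by positivity)]; linarith)
    have : ((Real.exp (-(v ^ 2 / 2)) : ℝ) : ℂ) - (1 - (v : ℂ) ^ 2 / 2) =
        ((Real.exp (-(v ^ 2 / 2)) - 1 - -(v ^ 2 / 2) : ℝ) : ℂ) := by push_cast; ring
    rw [this, Complex.norm_real, Real.norm_eq_abs]
    nlinarith [sq_nonneg v]
  calc _ = ‖(charFun (P.map ε) v - (1 - (v : ℂ) ^ 2 / 2)) -
        (((Real.exp (-(v ^ 2 / 2)) : ℝ) : ℂ) - (1 - (v : ℂ) ^ 2 / 2))‖ := by congr 1; ring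
    _ ≤ _ := (norm_sub_le _ _).trans (add_le_add hA hB)
    _ = η * v ^ 2 := by ring

/-- The multiplier `aₖ`, set to zero once `∑_{j ≤ k} aⱼ²` exceeds `2` or `|aₖ|` exceeds `δ`. -/
noncomputable def truncatedMultiplier (δ : ℝ) (a : ℕ → Ω → ℝ) (k : ℕ) (ω : Ω) : ℝ :=
  if ∑ j ∈ Finset.range (k + 1), a j ω ^ 2 ≤ 2 ∧ |a k ω| ≤ δ then a k ω else 0

/-- Truncation keeps predictability: the test at time `k` involves only `a 0, …, a k`, all known at
time `k`. -/
theorem measurable_truncatedMultiplier {δ : ℝ} {a : ℕ → Ω → ℝ} {n : ℕ}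
    (ha : ∀ k < n, Measurable[ℱ k] (a k)) {k : ℕ} (hk : k < n) :
    Measurable[ℱ k] (truncatedMultiplier δ a k) := by
  have h2 : Measurable[ℱ k] fun ω => ∑ j ∈ Finset.range (k + 1), a j ω ^ 2 := by
    refine Finset.measurable_fun_sum _ fun j hj => ?_
    rw [Finset.mem_range] at hj
    exact ((ha j (by omega)).mono (ℱ.mono (by omega)) le_rfl).pow_const 2
  have h3 : Measurable fun z : ℝ × ℝ => if z.1 ≤ 2 ∧ |z.2| ≤ δ then z.2 else 0 :=
    Measurable.ite ((measurableSet_le measurable_fst measurable_const).inter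
      (measurableSet_le measurable_snd.abs measurable_const)) measurable_snd measurable_const
  exact h3.comp (h2.prodMk (ha k hk))

theorem truncatedMultiplier_sq_le (δ : ℝ) (a : ℕ → Ω → ℝ) (k : ℕ) (ω : Ω) :
    truncatedMultiplier δ a k ω ^ 2 ≤ a k ω ^ 2 := by
  unfold truncatedMultiplier
  split_ifs
  · exact le_rfl
  · nlinarith [sq_nonneg (a k ω)]

/-- The test on the sum includes the current term, so the term that would overshoot `2` is already
removed. -/
theorem sum_truncatedMultiplier_sq_le (δ : ℝ) (a : ℕ → Ω → ℝ) (n : ℕ) (ω : Ω) :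
    ∑ j ∈ Finset.range n, truncatedMultiplier δ a j ω ^ 2 ≤ 2 := by
  induction n with
  | zero => simp
  | succ n ih =>
    by_cases h : ∑ j ∈ Finset.range (n + 1), a j ω ^ 2 ≤ 2
    · exact (Finset.sum_le_sum fun j _ => truncatedMultiplier_sq_le δ a j ω).trans h
    · rw [Finset.sum_range_succ, truncatedMultiplier, if_neg (fun h' => h h'.1)]
      simpa using ih

theorem abs_truncatedMultiplier_le {δ : ℝ} (hδ : 0 ≤ δ) (a : ℕ → Ω → ℝ) (k : ℕ) (ω : Ω) :
    |truncatedMultiplier δ a k ω| ≤ δ := by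
  unfold truncatedMultiplier
  split_ifs with h
  · exact h.2
  · simpa using hδ

theorem truncatedMultiplier_eq {δ : ℝ} {a : ℕ → Ω → ℝ} {n : ℕ} {ω : Ω}
    (hA : ∑ j ∈ Finset.range n, a j ω ^ 2 ≤ 2) (hδ : ∀ k < n, |a k ω| ≤ δ) {k : ℕ} (hk : k < n) :
    truncatedMultiplier δ a k ω = a k ω := by
  refine if_pos ⟨?_, hδ k hk⟩
  exact (Finset.sum_le_sum_of_subset_of_nonneg (Finset.range_mono hk)
    fun _ _ _ => sq_nonneg _).trans hA

/-- The quantitative form of the limit theorem. Off the two bad events the truncation is inactive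
(`γ ≤ 1` gives `∑ aⱼ² ≤ 2`), and `exp(iuS)` differs from `exp(-u²/2)` times the compensated
exponential by at most `κ`. On the bad events the trivial bound `1 + exp(u²)` is used. -/
theorem norm_integral_exp_sum_mul_sub_le [IsProbabilityMeasure P] {n : ℕ}
    (he : ∀ k, Measurable[ℱ (k + 1)] (e k))
    (hind : ∀ k, Indep (MeasurableSpace.comap (e k) inferInstance) (ℱ k) P)
    {μ : Measure ℝ} (hlaw : ∀ k, P.map (e k) = μ) {a : ℕ → Ω → ℝ}
    (ha : ∀ k < n, Measurable[ℱ k] (a k)) {u η δ γ κ : ℝ} (hη : 0 ≤ η) (hδ : 0 ≤ δ) (hγ : γ ≤ 1)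
    (hκ : 0 ≤ κ) (hφ : ∀ x : ℝ, |x| ≤ δ →
      ‖charFun μ (u * x) - Real.exp (-(u ^ 2 * x ^ 2 / 2))‖ ≤ η * x ^ 2)
    (hγκ : ∀ A : ℝ, |A - 1| < γ → |1 - Real.exp (-(u ^ 2 / 2)) * Real.exp (u ^ 2 * A / 2)| ≤ κ) :
    ‖∫ ω, Complex.exp (Complex.I * (u * ∑ j ∈ Finset.range n, a j ω * e j ω : ℝ)) ∂P -
      Real.exp (-(u ^ 2 / 2))‖ ≤ 2 * η * Real.exp (u ^ 2) + κ + (1 + Real.exp (u ^ 2)) *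
      (P.real {ω | γ ≤ |∑ j ∈ Finset.range n, a j ω ^ 2 - 1|} +
        P.real {ω | ∃ k < n, δ < |a k ω|}) := by
  set b := truncatedMultiplier δ a
  have hbm : ∀ k < n, Measurable[ℱ k] (b k) := fun k hk => measurable_truncatedMultiplier ha hk
  have hmain := norm_integral_compensatedExp_sub_one_le (P := P) (a := b) (u := u) he hind hlaw hbm
    (sum_truncatedMultiplier_sq_le δ a n) hη
    fun k _ ω => hφ _ (abs_truncatedMultiplier_le hδ a k ω)
  have ham : ∀ k < n, Measurable (a k) := fun k hk => (ha k hk).mono (ℱ.le k) le_rfl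
  have hem : ∀ k, Measurable (e k) := fun k => (he k).mono (ℱ.le (k + 1)) le_rfl
  set E : Ω → ℂ := fun ω =>
    Complex.exp (Complex.I * (u * ∑ j ∈ Finset.range n, a j ω * e j ω : ℝ))
  have hEnorm : ∀ ω, ‖E ω‖ = 1 := fun ω => by
    simp only [E, mul_comm Complex.I, Complex.norm_exp_ofReal_mul_I]
  have hSm : Measurable fun ω => ∑ j ∈ Finset.range n, a j ω * e j ω :=
    Finset.measurable_fun_sum _ fun j hj => (ham j (Finset.mem_range.1 hj)).mul (hem j)
  have hAm : Measurable fun ω => ∑ j ∈ Finset.range n, a j ω ^ 2 :=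
    Finset.measurable_fun_sum _ fun j hj => (ham j (Finset.mem_range.1 hj)).pow_const 2
  have hEm : Measurable E :=
    (by fun_prop : Measurable fun x : ℝ => Complex.exp (Complex.I * (u * x : ℝ))).comp hSm
  set C := compensatedExp u b e n
  have hCm : Measurable C := (measurable_compensatedExp he hbm u le_rfl).mono (ℱ.le n) le_rfl
  have hCnorm : ∀ ω, ‖C ω‖ ≤ Real.exp (u ^ 2) := fun ω => by
    rw [norm_compensatedExp]
    refine Real.exp_le_exp.2 ?_
    nlinarith [sum_truncatedMultiplier_sq_le δ a n ω, sq_nonneg u]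
  have hEint : Integrable E P := Integrable.of_bound hEm.aestronglyMeasurable 1
    (ae_of_all _ fun ω => (hEnorm ω).le)
  have hCint : Integrable C P := Integrable.of_bound hCm.aestronglyMeasurable _
    (ae_of_all _ hCnorm)
  set c : ℝ := Real.exp (-(u ^ 2 / 2))
  have hc0 : 0 < c := Real.exp_pos _
  have hc1 : c ≤ 1 := Real.exp_le_one_iff.2 (by have := sq_nonneg u; linarith)
  have hdecomp : ∫ ω, E ω ∂P - (c : ℂ) =
      ∫ ω, (E ω - c * C ω) ∂P + c * (∫ ω, C ω ∂P - 1) := by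
    rw [integral_sub hEint (hCint.const_mul _), integral_const_mul]; ring
  set B₁ : Set Ω := {ω | γ ≤ |∑ j ∈ Finset.range n, a j ω ^ 2 - 1|}
  set B₂ : Set Ω := {ω | ∃ k < n, δ < |a k ω|}
  have hB₁ : MeasurableSet B₁ :=
    measurableSet_le measurable_const (by fun_prop)
  have hB₂ : MeasurableSet B₂ := by
    have : B₂ = ⋃ k ∈ Finset.range n, {ω | δ < |a k ω|} := by ext ω; simp [B₂]
    rw [this]
    exact Finset.measurableSet_biUnion _ fun k hk =>
      measurableSet_lt measurable_const (ham k (Finset.mem_range.1 hk)).abs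
  have hgood : ∀ ω, ω ∉ B₁ → ω ∉ B₂ → ‖E ω - c * C ω‖ ≤ κ := by
    intro ω h1 h2
    simp only [B₁, B₂, Set.mem_ofPred_eq, not_le, not_exists, not_and, not_lt] at h1 h2
    have hA2 : ∑ j ∈ Finset.range n, a j ω ^ 2 ≤ 2 := by
      have := (abs_lt.1 h1).2; linarith
    have hb : ∀ j ∈ Finset.range n, b j ω = a j ω := fun j hj =>
      truncatedMultiplier_eq hA2 h2 (Finset.mem_range.1 hj)
    have hCe : C ω = E ω * (Real.exp (u ^ 2 * (∑ j ∈ Finset.range n, a j ω ^ 2) / 2) : ℝ) := by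
      simp only [C, E, compensatedExp]
      have hs : ∑ j ∈ Finset.range n, b j ω * e j ω = ∑ j ∈ Finset.range n, a j ω * e j ω :=
        Finset.sum_congr rfl fun j hj => by rw [hb j hj]
      have hs' : ∑ j ∈ Finset.range n, b j ω ^ 2 = ∑ j ∈ Finset.range n, a j ω ^ 2 :=
        Finset.sum_congr rfl fun j hj => by rw [hb j hj]
      rw [hs, hs']
    have : E ω - c * C ω = E ω * ((1 - c *
        Real.exp (u ^ 2 * (∑ j ∈ Finset.range n, a j ω ^ 2) / 2) : ℝ) : ℂ) := by
      rw [hCe, Complex.ofReal_sub, Complex.ofReal_mul, Complex.ofReal_one]; ring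
    rw [this, norm_mul, hEnorm, one_mul, Complex.norm_real, Real.norm_eq_abs]
    exact hγκ _ h1
  have hall : ∀ ω, ‖E ω - c * C ω‖ ≤ 1 + Real.exp (u ^ 2) := fun ω => by
    refine (norm_sub_le _ _).trans (add_le_add (hEnorm ω).le ?_)
    rw [norm_mul, Complex.norm_real, Real.norm_of_nonneg hc0.le]
    nlinarith [hCnorm ω, norm_nonneg (C ω)]
  have hpt : ∀ ω, ‖E ω - c * C ω‖ ≤ κ + (B₁.indicator (fun _ => 1 + Real.exp (u ^ 2)) ω +
      B₂.indicator (fun _ => 1 + Real.exp (u ^ 2)) ω) := by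
    intro ω
    have hp : 0 ≤ 1 + Real.exp (u ^ 2) := by positivity
    by_cases h1 : ω ∈ B₁ <;> by_cases h2 : ω ∈ B₂ <;>
      simp only [h1, h2, Set.indicator_of_mem, Set.indicator_of_notMem, not_false_eq_true] <;>
      first
      | linarith [hall ω]
      | linarith [hgood ω h1 h2]
  have hI₁ : Integrable (B₁.indicator (fun _ => 1 + Real.exp (u ^ 2))) P :=
    (integrable_const _).indicator hB₁
  have hI₂ : Integrable (B₂.indicator (fun _ => 1 + Real.exp (u ^ 2))) P :=
    (integrable_const _).indicator hB₂
  have h1 : ‖∫ ω, (E ω - c * C ω) ∂P‖ ≤ κ + (1 + Real.exp (u ^ 2)) * (P.real B₁ + P.real B₂) := by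
    refine (norm_integral_le_of_norm_le ((integrable_const κ).add (hI₁.add hI₂))
      (ae_of_all _ hpt)).trans (le_of_eq ?_)
    rw [integral_add' (integrable_const κ) (hI₁.add hI₂), integral_add' hI₁ hI₂,
      integral_indicator_const _ hB₁, integral_indicator_const _ hB₂]
    simp; ring
  have h2 : ‖(c : ℂ) * (∫ ω, C ω ∂P - 1)‖ ≤ 2 * η * Real.exp (u ^ 2) := by
    rw [norm_mul, Complex.norm_real, Real.norm_of_nonneg hc0.le]
    nlinarith [norm_nonneg (∫ ω, C ω ∂P - 1)]
  rw [hdecomp]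
  linarith [norm_add_le (∫ ω, (E ω - c * C ω) ∂P) ((c : ℂ) * (∫ ω, C ω ∂P - 1))]

/-- A martingale central limit theorem for `∑_{k < n} aₙₖ eₖ` with predictable multipliers `aₙₖ`
and identically distributed innovations `eₖ` independent of the past. -/
theorem tendstoInDistribution_sum_predictable_mul [IsProbabilityMeasure P]
    (he : ∀ k, Measurable[ℱ (k + 1)] (e k))
    (hind : ∀ k, Indep (MeasurableSpace.comap (e k) inferInstance) (ℱ k) P)
    (hlaw : ∀ k, P.map (e k) = P.map (e 0)) (h0 : ∫ ω, e 0 ω ∂P = 0)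
    (h1 : ∫ ω, e 0 ω ^ 2 ∂P = 1) {a : ℕ → ℕ → Ω → ℝ}
    (ha : ∀ n, ∀ k < n, Measurable[ℱ k] (a n k))
    (hA : TendstoInMeasure P (fun n ω => ∑ k ∈ Finset.range n, a n k ω ^ 2) atTop (fun _ => 1))
    (hmax : ∀ δ > 0, Tendsto (fun n => P.real {ω | ∃ k < n, δ < |a n k ω|}) atTop (𝓝 0)) :
    TendstoInDistribution (fun n ω => ∑ k ∈ Finset.range n, a n k ω * e k ω) atTop (id : ℝ → ℝ)
      (fun _ => P) (gaussianReal 0 1) := by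
  have hem : ∀ k, Measurable (e k) := fun k => (he k).mono (ℱ.le (k + 1)) le_rfl
  have hSm : ∀ n, Measurable fun ω => ∑ k ∈ Finset.range n, a n k ω * e k ω := fun n =>
    Finset.measurable_fun_sum _ fun j hj =>
      ((ha n j (Finset.mem_range.1 hj)).mono (ℱ.le j) le_rfl).mul (hem j)
  refine ⟨fun n => (hSm n).aemeasurable, aemeasurable_id, ?_⟩
  refine ProbabilityMeasure.tendsto_iff_tendsto_charFun.2 fun u => ?_
  have hlim : charFun ((gaussianReal 0 1).map id) u = (Real.exp (-(u ^ 2 / 2)) : ℝ) := by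
    rw [Measure.map_id, charFun_gaussianReal]
    push_cast; congr 1; simp
  have hchar : ∀ n, charFun (P.map fun ω => ∑ k ∈ Finset.range n, a n k ω * e k ω) u =
      ∫ ω, Complex.exp (Complex.I * (u * ∑ j ∈ Finset.range n, a n j ω * e j ω : ℝ)) ∂P := by
    intro n
    rw [charFun_apply_real, integral_map (hSm n).aemeasurable
      (Measurable.aestronglyMeasurable (by fun_prop))]
    congr 1; ext ω; congr 1; push_cast; ring
  simp only [ProbabilityMeasure.coe_mk, hlim, hchar]
  rw [Metric.tendsto_nhds]
  intro r hr
  -- The error budget is three shares of `r / 6`. The factor `12 exp(u²)` produces the first share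
  -- from `2 η exp(u²)`, and `u² + 1` absorbs the `u²` that appears when `v = u x`.
  obtain ⟨δ', hδ', hφ'⟩ := exists_norm_charFun_sub_exp_le (hem 0).aemeasurable h0 h1
    (η := r / (12 * Real.exp (u ^ 2) * (u ^ 2 + 1))) (by positivity)
  have hcont : Tendsto (fun A : ℝ => |1 - Real.exp (-(u ^ 2 / 2)) * Real.exp (u ^ 2 * A / 2)|)
      (𝓝 1) (𝓝 0) := by
    have hc : Continuous fun A : ℝ =>
      |1 - Real.exp (-(u ^ 2 / 2)) * Real.exp (u ^ 2 * A / 2)| := by fun_prop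
    have := hc.tendsto 1
    rwa [mul_one, ← Real.exp_add, neg_add_cancel, Real.exp_zero, sub_self, abs_zero] at this
  obtain ⟨γ', hγ', hκ⟩ := Metric.eventually_nhds_iff.1
    (hcont.eventually_lt_const (show (0 : ℝ) < r / 6 by positivity))
  set γ := min γ' 1
  have hγ : 0 < γ := by positivity
  -- The `+ 1` covers `u = 0`; then `|x| ≤ δ` forces `|u x| ≤ δ'`.
  set δ := δ' / (|u| + 1)
  have hδ : 0 < δ := by positivity
  have hbad : Tendsto (fun n => (1 + Real.exp (u ^ 2)) *
      (P.real {ω | γ ≤ |∑ j ∈ Finset.range n, a n j ω ^ 2 - 1|} +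
        P.real {ω | ∃ k < n, δ < |a n k ω|})) atTop (𝓝 0) := by
    have := ((tendstoInMeasure_iff_measureReal_norm.1 hA γ hγ).add (hmax δ hδ)).const_mul
      (1 + Real.exp (u ^ 2))
    simpa using this
  filter_upwards [hbad.eventually_lt_const (show (0 : ℝ) < r / 6 by positivity)] with n hn
  rw [dist_eq_norm]
  have hη : 0 ≤ r / (12 * Real.exp (u ^ 2)) := by positivity
  have := norm_integral_exp_sum_mul_sub_le (P := P) (u := u) (δ := δ) (γ := γ) (κ := r / 6)
    (η := r / (12 * Real.exp (u ^ 2))) he hind hlaw (ha n) hη hδ.le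
    (min_le_right _ _) (by positivity) (fun x hx => ?_) (fun A hA' => ?_)
  · have h3 : 2 * (r / (12 * Real.exp (u ^ 2))) * Real.exp (u ^ 2) = r / 6 := by
      field_simp; norm_num
    rw [h3] at this
    linarith
  · have hux : |u * x| ≤ δ' := by
      rw [abs_mul]
      calc |u| * |x| ≤ (|u| + 1) * δ := by gcongr; linarith
        _ = δ' := by simp only [δ]; field_simp
    have h3 := hφ' (u * x) hux
    rw [mul_pow] at h3
    refine h3.trans ?_
    have h4 : r / (12 * Real.exp (u ^ 2) * (u ^ 2 + 1)) * (u ^ 2 * x ^ 2) =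
      r / (12 * Real.exp (u ^ 2)) * x ^ 2 * (u ^ 2 / (u ^ 2 + 1)) := by field_simp
    rw [h4]
    refine mul_le_of_le_one_right (by positivity) ?_
    rw [div_le_one (by positivity)]; linarith
  · exact (hκ (by rw [Real.dist_eq]; exact hA'.trans_le (min_le_left _ _))).le

end MartingaleCLT

/-! ### Moment bounds and weak laws for weighted sums -/

section WeightedSums

variable {Ω : Type*} {mΩ : MeasurableSpace Ω} {P : Measure Ω} {ℱ : Filtration ℕ mΩ}
  {e a d : ℕ → Ω → ℝ}

theorem integral_abs_le_sqrt_integral_sq [IsProbabilityMeasure P] {f : Ω → ℝ} (hf : MemLp f 2 P) :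
    ∫ ω, |f ω| ∂P ≤ √(∫ ω, f ω ^ 2 ∂P) := by
  have h := variance_nonneg (fun ω => |f ω|) P
  rw [variance_eq_sub (X := fun ω => |f ω|) hf.abs] at h
  simp only [Pi.pow_apply, sq_abs] at h
  exact Real.le_sqrt_of_sq_le (by linarith)

theorem measurable_sum_mul {n : ℕ} (hd : ∀ k, Measurable[ℱ (k + 1)] (d k))
    (ha : ∀ k < n, Measurable[ℱ k] (a k)) :
    Measurable[ℱ n] fun ω => ∑ k ∈ Finset.range n, a k ω * d k ω :=
  Finset.measurable_fun_sum _ fun j hj => by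
    rw [Finset.mem_range] at hj
    exact ((ha j hj).mono (ℱ.mono hj.le) le_rfl).mul ((hd j).mono (ℱ.mono hj) le_rfl)

theorem memLp_mul_of_indep [IsProbabilityMeasure P] {k : ℕ} {f g : Ω → ℝ}
    (hf : Measurable[ℱ k] f) (hg : Measurable g)
    (hind : Indep (MeasurableSpace.comap g inferInstance) (ℱ k) P)
    (hf2 : MemLp f 2 P) (hg2 : MemLp g 2 P) : MemLp (fun ω => f ω * g ω) 2 P := by
  have hfm : Measurable f := hf.mono (ℱ.le k) le_rfl
  rw [memLp_two_iff_integrable_sq (f := fun ω => f ω * g ω) (hfm.mul hg).aestronglyMeasurable]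
  have hI := (indepFun_of_measurable_of_indep hf hind).comp
    (φ := fun x : ℝ => x ^ 2) (ψ := fun x : ℝ => x ^ 2) (by fun_prop) (by fun_prop)
  have := hI.integrable_mul hf2.integrable_sq hg2.integrable_sq
  refine this.congr (ae_of_all _ fun ω => ?_)
  simp [mul_pow]

theorem memLp_sum_mul [IsProbabilityMeasure P] {n : ℕ} (hd : ∀ k, Measurable[ℱ (k + 1)] (d k))
    (hind : ∀ k, Indep (MeasurableSpace.comap (d k) inferInstance) (ℱ k) P)
    (hd2 : ∀ k, MemLp (d k) 2 P) (ha : ∀ k < n, Measurable[ℱ k] (a k))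
    (ha2 : ∀ k < n, MemLp (a k) 2 P) :
    MemLp (fun ω => ∑ k ∈ Finset.range n, a k ω * d k ω) 2 P :=
  memLp_finsetSum _ fun k hk => memLp_mul_of_indep (ha k (Finset.mem_range.1 hk))
    ((hd k).mono (ℱ.le (k + 1)) le_rfl) (hind k) (ha2 k (Finset.mem_range.1 hk)) (hd2 k)

/-- Orthogonality of martingale differences: `d n` is centred and independent of everything it is
multiplied by in the cross term. -/
theorem integral_sum_mul_sq [IsProbabilityMeasure P] {n : ℕ}
    (hd : ∀ k, Measurable[ℱ (k + 1)] (d k))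
    (hind : ∀ k, Indep (MeasurableSpace.comap (d k) inferInstance) (ℱ k) P)
    (hd2 : ∀ k, MemLp (d k) 2 P) (hd0 : ∀ k, ∫ ω, d k ω ∂P = 0)
    (ha : ∀ k < n, Measurable[ℱ k] (a k)) (ha2 : ∀ k < n, MemLp (a k) 2 P) :
    ∫ ω, (∑ k ∈ Finset.range n, a k ω * d k ω) ^ 2 ∂P =
      ∑ k ∈ Finset.range n, (∫ ω, a k ω ^ 2 ∂P) * ∫ ω, d k ω ^ 2 ∂P := by
  induction n with
  | zero => simp
  | succ n ih =>
    have ha' : ∀ k < n, Measurable[ℱ k] (a k) := fun k hk => ha k (by omega)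
    have ha2' : ∀ k < n, MemLp (a k) 2 P := fun k hk => ha2 k (by omega)
    have hS := memLp_sum_mul hd hind hd2 ha' ha2'
    have hSm := measurable_sum_mul hd ha'
    have han := ha n (by omega)
    have hdm : Measurable (d n) := (hd n).mono (ℱ.le (n + 1)) le_rfl
    have hT := memLp_mul_of_indep han hdm (hind n) (ha2 n (by omega)) (hd2 n)
    have hcross : ∫ ω, (∑ k ∈ Finset.range n, a k ω * d k ω) * a n ω * d n ω ∂P = 0 := by
      have h := (indepFun_of_measurable_of_indep (hSm.mul han)
        (hind n)).integral_fun_mul_eq_mul_integral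
        ((hSm.mul han).mono (ℱ.le n) le_rfl).aestronglyMeasurable hdm.aestronglyMeasurable
      rw [hd0, mul_zero] at h
      exact h
    have hsq : ∫ ω, (a n ω * d n ω) ^ 2 ∂P = (∫ ω, a n ω ^ 2 ∂P) * ∫ ω, d n ω ^ 2 ∂P := by
      simp_rw [mul_pow]
      exact ((indepFun_of_measurable_of_indep han (hind n)).comp
        (φ := fun x : ℝ => x ^ 2) (ψ := fun x : ℝ => x ^ 2) (by fun_prop)
        (by fun_prop)).integral_fun_mul_eq_mul_integral
        ((han.mono (ℱ.le n) le_rfl).pow_const 2).aestronglyMeasurable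
        (hdm.pow_const 2).aestronglyMeasurable
    have hcint : Integrable
        (fun ω => 2 * ((∑ k ∈ Finset.range n, a k ω * d k ω) * a n ω * d n ω)) P := by
      refine ((hS.integrable_mul hT).const_mul 2).congr (ae_of_all _ fun ω => ?_)
      simp only [Pi.mul_apply]; ring
    calc ∫ ω, (∑ k ∈ Finset.range (n + 1), a k ω * d k ω) ^ 2 ∂P
        = ∫ ω, ((∑ k ∈ Finset.range n, a k ω * d k ω) ^ 2 +
          2 * ((∑ k ∈ Finset.range n, a k ω * d k ω) * a n ω * d n ω)) + (a n ω * d n ω) ^ 2 ∂P := by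
          congr 1; ext ω; rw [Finset.sum_range_succ]; ring
      _ = _ := by
          have h := integral_add (hS.integrable_sq.add hcint) hT.integrable_sq
          simp only [Pi.add_apply] at h
          rw [h, integral_add hS.integrable_sq hcint, integral_const_mul, hcross, hsq, ih ha' ha2',
            Finset.sum_range_succ]
          ring

theorem integral_abs_sum_mul_le [IsProbabilityMeasure P] {n : ℕ}
    (hd : ∀ k, Measurable[ℱ (k + 1)] (d k))
    (hind : ∀ k, Indep (MeasurableSpace.comap (d k) inferInstance) (ℱ k) P)
    (hd2 : ∀ k, MemLp (d k) 2 P) (hd0 : ∀ k, ∫ ω, d k ω ∂P = 0)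
    (ha : ∀ k < n, Measurable[ℱ k] (a k)) (ha2 : ∀ k < n, MemLp (a k) 2 P) {B V : ℝ}
    (hB : ∀ k < n, ∫ ω, a k ω ^ 2 ∂P ≤ B) (hV : ∀ k, ∫ ω, d k ω ^ 2 ∂P ≤ V) :
    ∫ ω, |∑ k ∈ Finset.range n, a k ω * d k ω| ∂P ≤ √(n * (B * V)) := by
  refine (integral_abs_le_sqrt_integral_sq (memLp_sum_mul hd hind hd2 ha ha2)).trans
    (Real.sqrt_le_sqrt ?_)
  rw [integral_sum_mul_sq hd hind hd2 hd0 ha ha2]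
  refine (Finset.sum_le_card_nsmul _ _ (B * V) fun k hk => ?_).trans (by simp)
  have hk := Finset.mem_range.1 hk
  have h1 : 0 ≤ ∫ ω, a k ω ^ 2 ∂P := integral_nonneg fun ω => sq_nonneg _
  have h2 : 0 ≤ ∫ ω, d k ω ^ 2 ∂P := integral_nonneg fun ω => sq_nonneg _
  exact mul_le_mul (hB k hk) (hV k) h2 (h1.trans (hB k hk))

theorem tendsto_sqrt_natCast_mul_div_atTop (B : ℝ) :
    Tendsto (fun n : ℕ => √(n * B) / n) atTop (𝓝 0) := by
  have h : Tendsto (fun n : ℕ => √B * (√(n : ℝ))⁻¹) atTop (𝓝 (√B * 0)) :=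
    (tendsto_inv_atTop_zero.comp
      (Real.tendsto_sqrt_atTop.comp tendsto_natCast_atTop_atTop)).const_mul _
  rw [mul_zero] at h
  refine h.congr fun n => ?_
  rw [Real.sqrt_mul (Nat.cast_nonneg n), mul_comm (√(n : ℝ)), mul_div_assoc, Real.sqrt_div_self']
  simp

theorem integral_comp_eq_of_map_eq {X Y : Ω → ℝ} (hX : Measurable X) (hY : Measurable Y)
    (h : P.map X = P.map Y) {f : ℝ → ℝ} (hf : Measurable f) :
    ∫ ω, f (X ω) ∂P = ∫ ω, f (Y ω) ∂P := by
  rw [← integral_map hX.aemeasurable hf.aestronglyMeasurable, h,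
    integral_map hY.aemeasurable hf.aestronglyMeasurable]

variable [IsProbabilityMeasure P]

/-- A weak law of large numbers in `L¹` for sums with a bounded triangular array of weights. -/
theorem tendsto_integral_abs_weighted_sum_div
    (he : ∀ k, Measurable[ℱ (k + 1)] (e k))
    (hind : ∀ k, Indep (MeasurableSpace.comap (e k) inferInstance) (ℱ k) P)
    (hlaw : ∀ k, P.map (e k) = P.map (e 0)) {f : ℝ → ℝ} (hf : Measurable f)
    (hfint : Integrable (fun ω => f (e 0 ω)) P) (hf0 : ∫ ω, f (e 0 ω) ∂P = 0)
    {c : ℕ → ℕ → ℝ} {C : ℝ} (hc : ∀ n k, |c n k| ≤ C) :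
    Tendsto (fun n : ℕ => (∫ ω, |∑ k ∈ Finset.range n, c n k * f (e k ω)| ∂P) / n) atTop
      (𝓝 0) := by
  have hem : ∀ k, Measurable (e k) := fun k => (he k).mono (ℱ.le (k + 1)) le_rfl
  have hC : 0 ≤ C := (abs_nonneg _).trans (hc 0 0)
  have hμ : IsProbabilityMeasure (P.map (e 0)) :=
    Measure.isProbabilityMeasure_map (hem 0).aemeasurable
  have hintk : ∀ k, ∀ g : ℝ → ℝ, Measurable g → Integrable g (P.map (e 0)) →
      Integrable (fun ω => g (e k ω)) P := fun k g hg hgi => by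
    rw [← hlaw k] at hgi
    exact (integrable_map_measure hg.aestronglyMeasurable (hem k).aemeasurable).1 hgi
  have hfμ : Integrable f (P.map (e 0)) :=
    (integrable_map_measure hf.aestronglyMeasurable (hem 0).aemeasurable).2 hfint
  have hfμ0 : ∫ x, f x ∂(P.map (e 0)) = 0 := by
    rw [integral_map (hem 0).aemeasurable hf.aestronglyMeasurable, hf0]
  rw [Metric.tendsto_nhds]
  intro r hr
  -- `f (e k)` is only integrable, so `f` is replaced by a bounded `g` close to it in `L¹`. The
  -- bounded part then has `L²` norm of order `√n`, while the remainder contributes at most `r / 2`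
  -- after division by `n`.
  obtain ⟨g, hg, hgi⟩ := hfμ.exists_boundedContinuous_integral_sub_le
    (show 0 < r / (4 * (C + 1)) by positivity)
  have hgm : Measurable g := g.continuous.measurable
  set m := ∫ x, g x ∂(P.map (e 0))
  have hm : |m| ≤ r / (4 * (C + 1)) := by
    have : m = -∫ x, (f x - g x) ∂(P.map (e 0)) := by
      rw [integral_sub hfμ hgi, hfμ0]; simp [m]
    rw [this, abs_neg]
    exact (abs_integral_le_integral_abs).trans hg
  -- Recentring restores mean zero, as orthogonality requires; since `f` has mean zero, `m` is as
  -- small as the approximation error.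
  set h : ℝ → ℝ := fun x => g x - m
  have hhm : Measurable h := hgm.sub_const m
  have hhb : ∀ x, |h x| ≤ ‖g‖ + |m| := fun x =>
    (abs_sub _ _).trans (by gcongr; exact g.norm_coe_le_norm x)
  have hhL : ∀ k, MemLp (fun ω => h (e k ω)) 2 P := fun k =>
    MemLp.of_bound (hhm.comp (hem k)).aestronglyMeasurable (‖g‖ + |m|) (ae_of_all _ fun ω => hhb _)
  have hh0 : ∀ k, ∫ ω, h (e k ω) ∂P = 0 := fun k => by
    rw [integral_comp_eq_of_map_eq (hem k) (hem 0) (hlaw k) hhm,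
      ← integral_map (hem 0).aemeasurable hhm.aestronglyMeasurable,
      integral_sub hgi (integrable_const _)]
    simp [m]
  have hV : ∀ k, ∫ ω, h (e k ω) ^ 2 ∂P ≤ (‖g‖ + |m|) ^ 2 := fun k => by
    have := integral_mono (μ := P) (hhL k).integrable_sq (integrable_const ((‖g‖ + |m|) ^ 2))
      fun ω => sq_le_sq' (abs_le.1 (hhb (e k ω))).1 (abs_le.1 (hhb (e k ω))).2
    simpa using this
  have hdiffint : ∀ k, Integrable (fun ω => |f (e k ω) - h (e k ω)|) P := fun k =>
    ((hintk k f hf hfμ).sub ((hhL k).integrable one_le_two)).abs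
  have hdiff : ∀ k, ∫ ω, |f (e k ω) - h (e k ω)| ∂P ≤ r / (2 * (C + 1)) := fun k => by
    have h1 : ∫ ω, |f (e k ω) - h (e k ω)| ∂P ≤ ∫ ω, (|f (e k ω) - g (e k ω)| + |m|) ∂P :=
      integral_mono (hdiffint k)
        (((hintk k f hf hfμ).sub (hintk k g hgm hgi)).abs.add (integrable_const _)) fun ω => by
          have : f (e k ω) - h (e k ω) = (f (e k ω) - g (e k ω)) + m := by simp only [h]; ring
          simp only [this]
          exact abs_add_le _ _
    have hfg : Integrable (fun ω => |f (e k ω) - g (e k ω)|) P :=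
      ((hintk k f hf hfμ).sub (hintk k g hgm hgi)).abs
    rw [integral_add hfg (integrable_const _)] at h1
    have h2 : ∫ ω, |f (e k ω) - g (e k ω)| ∂P ≤ r / (4 * (C + 1)) := by
      rw [integral_comp_eq_of_map_eq (hem k) (hem 0) (hlaw k) (f := fun x => |f x - g x|)
        (hf.sub hgm).abs,
        ← integral_map (f := fun x => |f x - g x|) (hem 0).aemeasurable
          (hf.sub hgm).abs.aestronglyMeasurable]
      exact hg
    have h3 : r / (2 * (C + 1)) = r / (4 * (C + 1)) + r / (4 * (C + 1)) := by field_simp; norm_num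
    simp only [integral_const, probReal_univ, one_smul] at h1
    linarith
  have hbound : ∀ n : ℕ, ∫ ω, |∑ k ∈ Finset.range n, c n k * f (e k ω)| ∂P ≤
      √(n * (C ^ 2 * (‖g‖ + |m|) ^ 2)) + n * (C * (r / (2 * (C + 1)))) := by
    intro n
    have hL := integral_abs_sum_mul_le (P := P) (ℱ := ℱ) (n := n) (a := fun k _ => c n k)
      (d := fun k ω => h (e k ω)) (fun k => hhm.comp (he k))
      (fun k => indep_of_indep_of_le_left (hind k) (by
        have : (fun ω => h (e k ω)) = h ∘ e k := rfl
        rw [this, ← MeasurableSpace.comap_comp]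
        exact MeasurableSpace.comap_mono hhm.comap_le)) hhL hh0
      (fun k _ => measurable_const) (fun k _ => memLp_const _) (B := C ^ 2)
      (V := (‖g‖ + |m|) ^ 2) (fun k _ => by
        simpa using (sq_le_sq' (abs_le.1 (hc n k)).1 (abs_le.1 (hc n k)).2)) hV
    have hsumint : Integrable (fun ω => ∑ k ∈ Finset.range n, C * |f (e k ω) - h (e k ω)|) P :=
      integrable_finsetSum _ fun k _ => (hdiffint k).const_mul C
    have hSint : Integrable (fun ω => |∑ k ∈ Finset.range n, c n k * h (e k ω)|) P :=
      (integrable_finsetSum _ fun k _ => ((hhL k).integrable one_le_two).const_mul (c n k)).abs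
    calc ∫ ω, |∑ k ∈ Finset.range n, c n k * f (e k ω)| ∂P
        ≤ ∫ ω, (|∑ k ∈ Finset.range n, c n k * h (e k ω)| +
            ∑ k ∈ Finset.range n, C * |f (e k ω) - h (e k ω)|) ∂P := by
          refine integral_mono (integrable_finsetSum _ fun k _ =>
            (hintk k f hf hfμ).const_mul (c n k)).abs (hSint.add hsumint) fun ω => ?_
          have : ∑ k ∈ Finset.range n, c n k * f (e k ω) = ∑ k ∈ Finset.range n, c n k * h (e k ω)
              + ∑ k ∈ Finset.range n, c n k * (f (e k ω) - h (e k ω)) := by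
            rw [← Finset.sum_add_distrib]; congr 1; ext k; ring
          simp only [this]
          refine (abs_add_le _ _).trans ?_
          gcongr
          refine (Finset.abs_sum_le_sum_abs _ _).trans (Finset.sum_le_sum fun k _ => ?_)
          rw [abs_mul]
          gcongr
          exact hc n k
      _ ≤ _ := by
          rw [integral_add hSint hsumint,
            integral_finsetSum _ fun k _ => (hdiffint k).const_mul C]
          refine add_le_add hL ((Finset.sum_le_card_nsmul _ _ (C * (r / (2 * (C + 1))))
            fun k _ => ?_).trans (by simp))
          rw [integral_const_mul]
          exact mul_le_mul_of_nonneg_left (hdiff k) hC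
  filter_upwards [(tendsto_sqrt_natCast_mul_div_atTop
    (C ^ 2 * (‖g‖ + |m|) ^ 2)).eventually_lt_const (half_pos hr), eventually_gt_atTop 0]
    with n hn hn0
  have hn0' : (0 : ℝ) < n := Nat.cast_pos.2 hn0
  rw [Real.dist_eq, sub_zero, abs_of_nonneg (div_nonneg (integral_nonneg fun _ => abs_nonneg _)
    hn0'.le)]
  have h1 : (∫ ω, |∑ k ∈ Finset.range n, c n k * f (e k ω)| ∂P) / n ≤
      √(n * (C ^ 2 * (‖g‖ + |m|) ^ 2)) / n + C * (r / (2 * (C + 1))) := by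
    rw [div_le_iff₀ hn0', add_mul, div_mul_cancel₀ _ hn0'.ne']
    linarith [hbound n]
  have h2 : C * (r / (2 * (C + 1))) ≤ r / 2 := by
    rw [mul_div_assoc', div_le_div_iff₀ (by positivity) two_pos]
    nlinarith
  linarith

/-- A union bound reduces to `n P(|e 0| > δ√n)`, which is at most `δ⁻² E[e 0²; |e 0| > δ√n]`. This
tends to zero by dominated convergence. Independence plays no role. -/
theorem tendsto_measureReal_exists_lt_abs {e : ℕ → Ω → ℝ} (he : ∀ k, Measurable (e k))
    (hlaw : ∀ k, P.map (e k) = P.map (e 0)) (h2 : MemLp (e 0) 2 P) {δ : ℝ} (hδ : 0 < δ) :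
    Tendsto (fun n : ℕ => P.real {ω | ∃ k < n, δ * √n < |e k ω|}) atTop (𝓝 0) := by
  set I : ℕ → ℝ := fun n => ∫ ω, {ω | δ * √n < |e 0 ω|}.indicator (fun ω => e 0 ω ^ 2) ω ∂P
  have hset : ∀ n : ℕ, MeasurableSet {ω | δ * √n < |e 0 ω|} := fun n =>
    measurableSet_lt measurable_const (he 0).abs
  have hI : Tendsto I atTop (𝓝 0) := by
    have h0 : (0 : ℝ) = ∫ _, (0 : ℝ) ∂P := by simp
    rw [h0]
    refine tendsto_integral_of_dominated_convergence (fun ω => e 0 ω ^ 2)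
      (fun n => (((he 0).pow_const 2).indicator (hset n)).aestronglyMeasurable) h2.integrable_sq
      (fun n => ae_of_all _ fun ω => ?_) (ae_of_all _ fun ω => ?_)
    · refine (norm_indicator_le_norm_self _ _).trans ?_
      rw [Real.norm_of_nonneg (sq_nonneg _)]
    · have ht : Tendsto (fun n : ℕ => δ * √(n : ℝ)) atTop atTop :=
        (Real.tendsto_sqrt_atTop.comp tendsto_natCast_atTop_atTop).const_mul_atTop hδ
      refine tendsto_const_nhds.congr' ?_
      filter_upwards [ht.eventually_ge_atTop |e 0 ω|] with n hn
      rw [Set.indicator_of_notMem]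
      simpa using hn
  have hle : ∀ n : ℕ, P.real {ω | ∃ k < n, δ * √n < |e k ω|} ≤ (δ ^ 2)⁻¹ * I n := by
    intro n
    have hk : ∀ k, P.real {ω | δ * √n < |e k ω|} = P.real {ω | δ * √n < |e 0 ω|} := fun k => by
      have hs : MeasurableSet {x : ℝ | δ * √n < |x|} :=
        measurableSet_lt measurable_const measurable_id.abs
      have h3 := map_measureReal_apply (μ := P) (he k) hs
      rw [hlaw k, map_measureReal_apply (he 0) hs] at h3
      exact h3.symm
    have hmarkov : δ ^ 2 * n * P.real {ω | δ * √n < |e 0 ω|} ≤ I n := by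
      have h3 : ∫ ω, {ω | δ * √n < |e 0 ω|}.indicator (fun _ => δ ^ 2 * n) ω ∂P ≤ I n := by
        refine integral_mono ((integrable_const _).indicator (hset n))
          (h2.integrable_sq.indicator (hset n)) fun ω => ?_
        by_cases hω : ω ∈ {ω | δ * √n < |e 0 ω|}
        · rw [Set.indicator_of_mem hω, Set.indicator_of_mem hω, ← sq_abs (e 0 ω)]
          have h4 : (δ * √n) ^ 2 ≤ |e 0 ω| ^ 2 :=
            pow_le_pow_left₀ (by positivity) (le_of_lt hω) 2
          rwa [mul_pow, Real.sq_sqrt (Nat.cast_nonneg n)] at h4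
        · rw [Set.indicator_of_notMem hω, Set.indicator_of_notMem hω]
      rw [integral_indicator_const _ (hset n), smul_eq_mul] at h3
      linarith
    have hunion : {ω | ∃ k < n, δ * √n < |e k ω|} =
        ⋃ k ∈ Finset.range n, {ω | δ * √n < |e k ω|} := by ext ω; simp
    rw [hunion]
    refine (measureReal_biUnion_finset_le _ _).trans ?_
    rw [Finset.sum_congr rfl fun k _ => hk k, Finset.sum_const, Finset.card_range, nsmul_eq_mul,
      le_inv_mul_iff₀ (by positivity)]
    linarith
  have := hI.const_mul (δ ^ 2)⁻¹
  rw [mul_zero] at this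
  exact squeeze_zero (fun n => measureReal_nonneg) hle this

end WeightedSums

/-! ### Summation by parts along a linear recursion -/

section BackwardWeight

/-- The weights `cⱼ = ∑_{j ≤ k < n} wₖ q^(k-j)`, the solution of `cⱼ = wⱼ + q cⱼ₊₁`, `cₙ = 0`. -/
def backwardWeight (q : ℝ) (w : ℕ → ℝ) (n j : ℕ) : ℝ :=
  ∑ i ∈ Finset.range (n - j), w (j + i) * q ^ i

theorem backwardWeight_eq (q : ℝ) (w : ℕ → ℝ) {n j : ℕ} (hj : j < n) :
    backwardWeight q w n j = w j + q * backwardWeight q w n (j + 1) := by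
  obtain ⟨k, rfl⟩ : ∃ k, n = j + 1 + k := ⟨n - (j + 1), by omega⟩
  simp only [backwardWeight, show j + 1 + k - j = k + 1 by omega,
    show j + 1 + k - (j + 1) = k by omega]
  rw [Finset.sum_range_succ', Finset.mul_sum, add_comm]
  simp only [add_zero, pow_zero, mul_one]
  congr 1
  refine Finset.sum_congr rfl fun i _ => ?_
  rw [show j + 1 + i = j + (i + 1) by ring]; ring

theorem abs_backwardWeight_le {q : ℝ} (hq : 0 ≤ q) (hq1 : q < 1) {w : ℕ → ℝ} {W : ℝ}
    (hw : ∀ k, |w k| ≤ W) (n j : ℕ) : |backwardWeight q w n j| ≤ W / (1 - q) := by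
  have hW : 0 ≤ W := (abs_nonneg _).trans (hw 0)
  calc |backwardWeight q w n j| ≤ ∑ i ∈ Finset.range (n - j), |w (j + i) * q ^ i| :=
        Finset.abs_sum_le_sum_abs _ _
    _ ≤ ∑ i ∈ Finset.range (n - j), W * q ^ i := Finset.sum_le_sum fun i _ => by
        rw [abs_mul, abs_of_nonneg (pow_nonneg hq i)]
        exact mul_le_mul_of_nonneg_right (hw _) (pow_nonneg hq i)
    _ ≤ W * (1 - q)⁻¹ := by
        rw [← Finset.mul_sum]
        refine mul_le_mul_of_nonneg_left ?_ hW
        rw [← tsum_geometric_of_lt_one hq hq1]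
        exact (summable_geometric_of_lt_one hq hq1).sum_le_tsum _ fun i _ => pow_nonneg hq i
    _ = W / (1 - q) := (div_eq_mul_inv _ _).symm

/-- Telescoping `cⱼ Dⱼ`, with `cₙ = 0`, expresses a weighted sum of `D` through its innovations `D
(j+1) - q D j`. The new weights stay bounded uniformly in `n` when `w` is bounded and `0 ≤ q < 1`.
-/
theorem sum_mul_eq_sum_backwardWeight_mul (q : ℝ) (w D : ℕ → ℝ) (n : ℕ) :
    ∑ j ∈ Finset.range n, w j * D j = backwardWeight q w n 0 * D 0 +
      ∑ j ∈ Finset.range n, backwardWeight q w n (j + 1) * (D (j + 1) - q * D j) := by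
  have h1 := Finset.sum_range_sub' (fun j => backwardWeight q w n j * D j) n
  have h2 : backwardWeight q w n n = 0 := by simp [backwardWeight]
  rw [h2, zero_mul, sub_zero] at h1
  rw [← h1, ← Finset.sum_add_distrib]
  refine Finset.sum_congr rfl fun j hj => ?_
  rw [backwardWeight_eq q w (Finset.mem_range.1 hj)]; ring

end BackwardWeight

/-! ### Index shifts and convergence in probability from `L¹` bounds -/

theorem sum_Icc_two_eq_sum_range (f : ℕ → ℝ) (n : ℕ) :
    ∑ t ∈ Finset.Icc 2 n, f t = ∑ k ∈ Finset.range n, if k = 0 then 0 else f (k + 1) := by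
  induction n with
  | zero => simp
  | succ n ih =>
    rw [Finset.sum_range_succ, ← ih]
    rcases Nat.eq_zero_or_pos n with rfl | hn
    · simp
    · rw [Finset.sum_Icc_succ_top (by omega), if_neg hn.ne']

theorem sum_Icc_one_eq_sum_range (f : ℕ → ℝ) (n : ℕ) :
    ∑ t ∈ Finset.Icc 1 n, f t = ∑ k ∈ Finset.range n, f (k + 1) := by
  induction n with
  | zero => simp
  | succ n ih => rw [Finset.sum_range_succ, ← ih, Finset.sum_Icc_succ_top (by omega)]

theorem tendsto_measureReal_mul_le_abs {Ω : Type*} {mΩ : MeasurableSpace Ω} {P : Measure Ω}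
    {Y : ℕ → Ω → ℝ} (hY : ∀ n, Integrable (Y n) P)
    (h : Tendsto (fun n : ℕ => (∫ ω, |Y n ω| ∂P) / n) atTop (𝓝 0)) {δ : ℝ} (hδ : 0 < δ) :
    Tendsto (fun n : ℕ => P.real {ω | δ * n ≤ |Y n ω|}) atTop (𝓝 0) := by
  have h' := h.const_mul δ⁻¹
  rw [mul_zero] at h'
  refine tendsto_of_tendsto_of_tendsto_of_le_of_le' tendsto_const_nhds h'
    (Eventually.of_forall fun n => measureReal_nonneg) ?_
  filter_upwards [eventually_gt_atTop 0] with n hn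
  have hn : (0 : ℝ) < n := Nat.cast_pos.2 hn
  have := mul_meas_ge_le_integral_of_nonneg (ae_of_all P fun ω => abs_nonneg (Y n ω)) (hY n).abs
    (δ * n)
  rw [← div_eq_inv_mul, le_div_iff₀ hδ, le_div_iff₀ hn]
  linarith

theorem tendsto_measureReal_of_eventually_subset {Ω : Type*} {mΩ : MeasurableSpace Ω}
    {P : Measure Ω} [IsFiniteMeasure P] {s t : ℕ → Set Ω}
    (ht : Tendsto (fun n => P.real (t n)) atTop (𝓝 0)) (hst : ∀ᶠ n in atTop, s n ⊆ t n) :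
    Tendsto (fun n => P.real (s n)) atTop (𝓝 0) :=
  tendsto_of_tendsto_of_tendsto_of_le_of_le' tendsto_const_nhds ht
    (Eventually.of_forall fun _ => measureReal_nonneg)
    (hst.mono fun _ h => measureReal_mono h)

/-! ### The autoregressive process: filtration, second moments, weak law, maximum -/

namespace IsHeteroscedasticAR1

variable {Ω : Type*} {mΩ : MeasurableSpace Ω} {P : Measure Ω} {θ₀ : ℝ} {τ : ℕ → ℝ}
  {ε X : ℕ → Ω → ℝ}

theorem succ_eq (hX : IsHeteroscedasticAR1 P θ₀ τ ε X) (k : ℕ) (ω : Ω) :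
    X (k + 1) ω = θ₀ * X k ω + τ (k + 1) * ε (k + 1) ω := hX.recursion (k + 1) (by omega) ω

theorem measurable (hX : IsHeteroscedasticAR1 P θ₀ τ ε X) (k : ℕ) : Measurable (X k) := by
  induction k with
  | zero => exact hX.measurable_init
  | succ k ih =>
    rw [funext (hX.succ_eq k)]
    exact (ih.const_mul _).add ((hX.measurable_error (k + 1) (by omega)).const_mul _)

theorem memLp_two (hX : IsHeteroscedasticAR1 P θ₀ τ ε X) (k : ℕ) : MemLp (X k) 2 P := by
  induction k with
  | zero => exact_mod_cast hX.moments_init 2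
  | succ k ih =>
    rw [funext (hX.succ_eq k)]
    exact (ih.const_mul _).add ((hX.memLp_error (k + 1) (by omega)).const_mul _)

theorem sq_lt_one (hX : IsHeteroscedasticAR1 P θ₀ τ ε X) : θ₀ ^ 2 < 1 := by
  rw [sq_lt_one_iff_abs_lt_one]; exact hX.abs_lt_one

/-- The filtration generated by the observations. -/
def filtration (hX : IsHeteroscedasticAR1 P θ₀ τ ε X) : Filtration ℕ mΩ :=
  Filtration.natural X fun k => (hX.measurable k).stronglyMeasurable

theorem measurable_filtration (hX : IsHeteroscedasticAR1 P θ₀ τ ε X) (k : ℕ) :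
    Measurable[hX.filtration k] (X k) :=
  Measurable.of_comap_le (le_iSup₂_of_le (f := fun j (_ : j ≤ k) =>
    MeasurableSpace.comap (X j) inferInstance) k le_rfl le_rfl)

/-- The recursion can be solved for the error because `τ (k+1) ≠ 0`. -/
theorem measurable_error_filtration (hX : IsHeteroscedasticAR1 P θ₀ τ ε X) (k : ℕ) :
    Measurable[hX.filtration (k + 1)] (ε (k + 1)) := by
  have h : ε (k + 1) = fun ω => (X (k + 1) ω - θ₀ * X k ω) / τ (k + 1) := by
    ext ω
    have := (hX.scale_pos (k + 1) (by omega)).ne'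
    rw [hX.succ_eq]; field_simp; ring
  rw [h]
  exact ((hX.measurable_filtration (k + 1)).sub (((hX.measurable_filtration k).mono
    (hX.filtration.mono k.le_succ) le_rfl).const_mul _)).div_const _

theorem indep_filtration (hX : IsHeteroscedasticAR1 P θ₀ τ ε X) (k : ℕ) :
    Indep (MeasurableSpace.comap (ε (k + 1)) inferInstance) (hX.filtration k) P := by
  have h := hX.indep_past (k + 1) (by omega)
  rw [IndepFun_iff_Indep] at h
  refine indep_of_indep_of_le_right h (iSup₂_le fun j hj => ?_)
  rintro s ⟨t, ht, rfl⟩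
  have hj' : j < k + 1 := by omega
  have hm : Measurable fun f : Fin (k + 1) → ℝ => f ⟨j, hj'⟩ := measurable_pi_apply _
  exact ⟨(fun f : Fin (k + 1) → ℝ => f ⟨j, hj'⟩) ⁻¹' t, hm ht, rfl⟩

theorem map_error_eq (hX : IsHeteroscedasticAR1 P θ₀ τ ε X) (k : ℕ) :
    P.map (ε (k + 1)) = P.map (ε (0 + 1)) :=
  (hX.identDistrib_error (k + 1) (0 + 1) (by omega) (by omega)).map_eq

theorem integral_error_sq [IsProbabilityMeasure P] (hX : IsHeteroscedasticAR1 P θ₀ τ ε X) (k : ℕ) :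
    ∫ ω, ε (k + 1) ω ^ 2 ∂P = 1 := by
  have h := hX.variance_error (k + 1) (by omega)
  rw [variance_eq_sub (hX.memLp_error (k + 1) (by omega)), hX.mean_error (k + 1) (by omega)] at h
  simpa using h

theorem integral_sq_succ [IsProbabilityMeasure P] (hX : IsHeteroscedasticAR1 P θ₀ τ ε X) (k : ℕ) :
    ∫ ω, X (k + 1) ω ^ 2 ∂P = θ₀ ^ 2 * ∫ ω, X k ω ^ 2 ∂P + τ (k + 1) ^ 2 := by
  have hX2 := hX.memLp_two k
  have hε2 := hX.memLp_error (k + 1) (by omega)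
  have hcross : ∫ ω, X k ω * ε (k + 1) ω ∂P = 0 := by
    rw [(indepFun_of_measurable_of_indep (hX.measurable_filtration k)
      (hX.indep_filtration k)).integral_fun_mul_eq_mul_integral hX2.1 hε2.1,
      hX.mean_error (k + 1) (by omega), mul_zero]
  have hi1 := hX2.integrable_sq.const_mul (θ₀ ^ 2)
  have hi2 : Integrable (fun ω => 2 * θ₀ * τ (k + 1) * (X k ω * ε (k + 1) ω)) P :=
    (hX2.integrable_mul hε2).const_mul _
  have hi3 := hε2.integrable_sq.const_mul (τ (k + 1) ^ 2)
  calc ∫ ω, X (k + 1) ω ^ 2 ∂P = ∫ ω, (θ₀ ^ 2 * X k ω ^ 2 +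
        (2 * θ₀ * τ (k + 1) * (X k ω * ε (k + 1) ω) + τ (k + 1) ^ 2 * ε (k + 1) ω ^ 2)) ∂P := by
        congr 1; ext ω; rw [hX.succ_eq]; ring
    _ = _ := by
        have h := integral_add hi1 (hi2.add hi3)
        simp only [Pi.add_apply] at h
        rw [h, integral_add hi2 hi3, integral_const_mul, integral_const_mul, integral_const_mul,
          hcross, hX.integral_error_sq]
        ring

theorem integral_sq_nonneg (X : ℕ → Ω → ℝ) (k : ℕ) : 0 ≤ ∫ ω, X k ω ^ 2 ∂P :=
  integral_nonneg fun _ => sq_nonneg _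

theorem integral_sq_le [IsProbabilityMeasure P] (hX : IsHeteroscedasticAR1 P θ₀ τ ε X) {M₂ : ℝ}
    (hM : ∀ t, 1 ≤ t → τ t ≤ M₂) (k : ℕ) :
    ∫ ω, X k ω ^ 2 ∂P ≤ ∫ ω, X 0 ω ^ 2 ∂P + M₂ ^ 2 / (1 - θ₀ ^ 2) := by
  have hθ := hX.sq_lt_one
  have h1 : 0 < 1 - θ₀ ^ 2 := by linarith
  induction k with
  | zero => have : 0 ≤ M₂ ^ 2 / (1 - θ₀ ^ 2) := by positivity
            linarith
  | succ k ih =>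
    rw [hX.integral_sq_succ]
    have h2 : τ (k + 1) ^ 2 ≤ M₂ ^ 2 := pow_le_pow_left₀ (hX.scale_pos _ (by omega)).le
      (hM _ (by omega)) 2
    have h3 : M₂ ^ 2 = M₂ ^ 2 / (1 - θ₀ ^ 2) * (1 - θ₀ ^ 2) := by field_simp
    nlinarith [integral_sq_nonneg (P := P) X 0, sq_nonneg θ₀]

theorem abs_scale_le (hX : IsHeteroscedasticAR1 P θ₀ τ ε X) {M₂ : ℝ}
    (hM : ∀ t, 1 ≤ t → τ t ≤ M₂) (k : ℕ) : |τ (k + 1)| ≤ M₂ := by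
  rw [abs_of_pos (hX.scale_pos _ (by omega))]; exact hM _ (by omega)

theorem integrable_sum_sq_sub [IsProbabilityMeasure P] (hX : IsHeteroscedasticAR1 P θ₀ τ ε X)
    (w : ℕ → ℝ) (n : ℕ) : Integrable (fun ω => ∑ k ∈ Finset.range n,
      w k * (X k ω ^ 2 - ∫ ω', X k ω' ^ 2 ∂P)) P :=
  integrable_finsetSum _ fun k _ =>
    (((hX.memLp_two k).integrable_sq.sub (integrable_const _)).const_mul _)

/-- A weak law of large numbers in `L¹` for bounded weighted averages of `Xₖ²`. -/
theorem tendsto_integral_abs_sum_sq_sub_div [IsProbabilityMeasure P]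
    (hX : IsHeteroscedasticAR1 P θ₀ τ ε X) {M₂ : ℝ} (hM : ∀ t, 1 ≤ t → τ t ≤ M₂)
    {w : ℕ → ℝ} {W : ℝ} (hw : ∀ k, |w k| ≤ W) :
    Tendsto (fun n : ℕ => (∫ ω, |∑ k ∈ Finset.range n,
      w k * (X k ω ^ 2 - ∫ ω', X k ω' ^ 2 ∂P)| ∂P) / n) atTop (𝓝 0) := by
  have hM0 : 0 ≤ M₂ := (abs_nonneg _).trans (hX.abs_scale_le hM 0)
  have hem : ∀ k, Measurable (ε (k + 1)) := fun k => hX.measurable_error (k + 1) (by omega)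
  have he2 : ∀ k, MemLp (ε (k + 1)) 2 P := fun k => hX.memLp_error (k + 1) (by omega)
  set c := backwardWeight (θ₀ ^ 2) w
  set C := W / (1 - θ₀ ^ 2)
  have hc : ∀ n j, |c n j| ≤ C := abs_backwardWeight_le (sq_nonneg _) hX.sq_lt_one hw
  have hC : 0 ≤ C := (abs_nonneg _).trans (hc 0 0)
  set D : ℕ → Ω → ℝ := fun k ω => X k ω ^ 2 - ∫ ω', X k ω' ^ 2 ∂P
  have hD0 : Integrable (D 0) P := (hX.memLp_two 0).integrable_sq.sub (integrable_const _)
  set B := ∫ ω, X 0 ω ^ 2 ∂P + M₂ ^ 2 / (1 - θ₀ ^ 2)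
  have hB : ∀ k, ∫ ω, X k ω ^ 2 ∂P ≤ B := hX.integral_sq_le hM
  -- The innovation of the centred square has two parts. The first is a predictable
  -- square-integrable multiple of `ε (k+1)`, handled by orthogonality. The second is a
  -- deterministic multiple of `ε (k+1)² - 1`, which is only integrable and needs the `L¹` weak law.
  have hDrec : ∀ k ω, D (k + 1) ω - θ₀ ^ 2 * D k ω =
      2 * θ₀ * τ (k + 1) * X k ω * ε (k + 1) ω + τ (k + 1) ^ 2 * (ε (k + 1) ω ^ 2 - 1) := by
    intro k ω
    simp only [D]
    rw [hX.integral_sq_succ, hX.succ_eq]; ring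
  set S₁ : ℕ → Ω → ℝ := fun n ω => ∑ k ∈ Finset.range n,
    (c n (k + 1) * (2 * θ₀ * τ (k + 1)) * X k ω) * ε (k + 1) ω
  set S₂ : ℕ → Ω → ℝ := fun n ω => ∑ k ∈ Finset.range n,
    (c n (k + 1) * τ (k + 1) ^ 2) * (ε (k + 1) ω ^ 2 - 1)
  have hdecomp : ∀ n ω, ∑ k ∈ Finset.range n, w k * D k ω = c n 0 * D 0 ω + (S₁ n ω + S₂ n ω) := by
    intro n ω
    rw [sum_mul_eq_sum_backwardWeight_mul (θ₀ ^ 2) w (fun k => D k ω) n, ← Finset.sum_add_distrib]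
    congr 1
    refine Finset.sum_congr rfl fun k _ => ?_
    rw [hDrec]; ring
  have hcoef : ∀ n k, |c n (k + 1) * (2 * θ₀ * τ (k + 1))| ≤ C * (2 * M₂) := by
    intro n k
    rw [abs_mul, abs_mul, abs_mul, abs_two]
    have := hX.abs_scale_le hM k
    have := hX.abs_lt_one.le
    have := hc n (k + 1)
    calc _ ≤ C * (2 * 1 * M₂) := by gcongr
      _ = _ := by ring
  have hS₁L : ∀ n, MemLp (S₁ n) 2 P := fun n =>
    memLp_sum_mul (ℱ := hX.filtration) (d := fun k => ε (k + 1))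
      (a := fun k ω => c n (k + 1) * (2 * θ₀ * τ (k + 1)) * X k ω)
      hX.measurable_error_filtration hX.indep_filtration he2
      (fun k _ => (hX.measurable_filtration k).const_mul _)
      (fun k _ => (hX.memLp_two k).const_mul _)
  have hS₁ : ∀ n : ℕ, ∫ ω, |S₁ n ω| ∂P ≤ √(n * ((C * (2 * M₂)) ^ 2 * B * 1)) := fun n =>
    integral_abs_sum_mul_le (ℱ := hX.filtration) (d := fun k => ε (k + 1))
      (a := fun k ω => c n (k + 1) * (2 * θ₀ * τ (k + 1)) * X k ω)
      hX.measurable_error_filtration hX.indep_filtration he2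
      (fun k => hX.mean_error (k + 1) (by omega))
      (fun k _ => (hX.measurable_filtration k).const_mul _)
      (fun k _ => (hX.memLp_two k).const_mul _)
      (fun k _ => by
        simp_rw [mul_pow _ (X k _)]
        rw [integral_const_mul]
        have h1 := hcoef n k
        have h2 : (c n (k + 1) * (2 * θ₀ * τ (k + 1))) ^ 2 ≤ (C * (2 * M₂)) ^ 2 :=
          sq_le_sq' (abs_le.1 h1).1 (abs_le.1 h1).2
        exact mul_le_mul h2 (hB k) (integral_sq_nonneg X k) (sq_nonneg _))
      (fun k => (hX.integral_error_sq k).le)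
  have hfint : Integrable (fun ω => ε (0 + 1) ω ^ 2 - 1) P :=
    (he2 0).integrable_sq.sub (integrable_const _)
  have hS₂int : ∀ n, Integrable (S₂ n) P := fun n => integrable_finsetSum _ fun k _ =>
    ((he2 k).integrable_sq.sub (integrable_const _)).const_mul _
  have hS₂ : Tendsto (fun n : ℕ => (∫ ω, |S₂ n ω| ∂P) / n) atTop (𝓝 0) :=
    tendsto_integral_abs_weighted_sum_div (ℱ := hX.filtration) (e := fun k => ε (k + 1))
      (f := fun x => x ^ 2 - 1) (c := fun n k => c n (k + 1) * τ (k + 1) ^ 2) (C := C * M₂ ^ 2)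
      hX.measurable_error_filtration hX.indep_filtration hX.map_error_eq (by fun_prop) hfint
      (by
        rw [integral_sub (he2 0).integrable_sq (integrable_const _), hX.integral_error_sq]
        simp)
      (fun n k => by
        rw [abs_mul, abs_pow]
        have := hX.abs_scale_le hM k
        have := hc n (k + 1)
        gcongr)
  have hlim : Tendsto (fun n : ℕ => C * (∫ ω, |D 0 ω| ∂P) / n +
      (√(n * ((C * (2 * M₂)) ^ 2 * B * 1)) / n + (∫ ω, |S₂ n ω| ∂P) / n)) atTop (𝓝 0) := by
    have := (tendsto_const_div_atTop_nhds_zero_nat (C * ∫ ω, |D 0 ω| ∂P)).add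
      ((tendsto_sqrt_natCast_mul_div_atTop ((C * (2 * M₂)) ^ 2 * B * 1)).add hS₂)
    simpa using this
  refine squeeze_zero (fun n => div_nonneg (integral_nonneg fun _ => abs_nonneg _)
    (Nat.cast_nonneg n)) (fun n => ?_) hlim
  rw [← add_div, ← add_div]
  refine div_le_div_of_nonneg_right ?_ (Nat.cast_nonneg n)
  have hS₁i : Integrable (fun ω => |S₁ n ω|) P := ((hS₁L n).integrable one_le_two).abs
  have hS₂i : Integrable (fun ω => |S₂ n ω|) P := (hS₂int n).abs
  have hDi : Integrable (fun ω => C * |D 0 ω|) P := hD0.abs.const_mul C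
  calc ∫ ω, |∑ k ∈ Finset.range n, w k * D k ω| ∂P
      ≤ ∫ ω, (C * |D 0 ω| + (|S₁ n ω| + |S₂ n ω|)) ∂P := by
        refine integral_mono (hX.integrable_sum_sq_sub w n).abs
          (hDi.add (hS₁i.add hS₂i)) fun ω => ?_
        simp only [hdecomp]
        refine (abs_add_le _ _).trans (add_le_add ?_ (abs_add_le _ _))
        rw [abs_mul]
        exact mul_le_mul_of_nonneg_right (hc n 0) (abs_nonneg _)
    _ = C * ∫ ω, |D 0 ω| ∂P + (∫ ω, |S₁ n ω| ∂P + ∫ ω, |S₂ n ω| ∂P) := by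
        have h := integral_add hDi (hS₁i.add hS₂i)
        simp only [Pi.add_apply] at h
        rw [h, integral_add hS₁i hS₂i, integral_const_mul]
    _ ≤ _ := by gcongr; exact hS₁ n

/-- A pathwise bound: the contraction `|θ₀| < 1` sums the errors geometrically. It transfers the
maximal bound from the errors to the process. -/
theorem abs_le_of_abs_error_le (hX : IsHeteroscedasticAR1 P θ₀ τ ε X) {M₂ : ℝ}
    (hM : ∀ t, 1 ≤ t → τ t ≤ M₂) {ω : Ω} {n : ℕ} {η : ℝ} (hη : ∀ k < n, |ε (k + 1) ω| ≤ η)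
    (hη0 : 0 ≤ η) {k : ℕ} (hk : k ≤ n) : |X k ω| ≤ |X 0 ω| + M₂ * η / (1 - |θ₀|) := by
  have hM0 : 0 ≤ M₂ := (abs_nonneg _).trans (hX.abs_scale_le hM 0)
  have hθ : 0 < 1 - |θ₀| := by linarith [hX.abs_lt_one]
  induction k with
  | zero => have : 0 ≤ M₂ * η / (1 - |θ₀|) := by positivity
            linarith
  | succ k ih =>
    have ih := ih (by omega)
    rw [hX.succ_eq]
    have h1 : |τ (k + 1)| * |ε (k + 1) ω| ≤ M₂ * η :=
      mul_le_mul (hX.abs_scale_le hM k) (hη k (by omega)) (abs_nonneg _) hM0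
    have h2 : M₂ * η = M₂ * η / (1 - |θ₀|) * (1 - |θ₀|) := by field_simp
    refine (abs_add_le _ _).trans ?_
    rw [abs_mul, abs_mul]
    nlinarith [abs_nonneg θ₀, abs_nonneg (X 0 ω)]

theorem tendsto_measureReal_exists_lt_abs [IsProbabilityMeasure P]
    (hX : IsHeteroscedasticAR1 P θ₀ τ ε X) {M₂ : ℝ} (hM₂ : 0 < M₂) (hM : ∀ t, 1 ≤ t → τ t ≤ M₂)
    {δ : ℝ} (hδ : 0 < δ) :
    Tendsto (fun n : ℕ => P.real {ω | ∃ k < n, δ * √n < |X k ω|}) atTop (𝓝 0) := by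
  have hθ : 0 < 1 - |θ₀| := by linarith [hX.abs_lt_one]
  -- Chosen so that errors below `δ'√n` contribute at most `(δ/2)√n` to `X k`; the other half is
  -- left for `X 0`.
  set δ' := δ * (1 - |θ₀|) / (2 * M₂)
  have h1 := _root_.tendsto_measureReal_exists_lt_abs (P := P) (e := fun k => ε (k + 1))
    (fun k => hX.measurable_error _ (by omega)) hX.map_error_eq (hX.memLp_error _ (by omega))
    (show 0 < δ' by positivity)
  have h2 := _root_.tendsto_measureReal_exists_lt_abs (P := P) (e := fun _ => X 0)
    (fun _ => hX.measurable 0) (fun _ => rfl) (hX.memLp_two 0) (half_pos hδ)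
  have h3 := h2.add h1
  rw [add_zero] at h3
  refine squeeze_zero (fun n => measureReal_nonneg) (fun n => ?_) h3
  refine (measureReal_mono ?_).trans (measureReal_union_le _ _)
  rintro ω ⟨k, hk, hlt⟩
  by_contra hcon
  simp only [Set.mem_union, Set.mem_ofPred_eq, not_or, not_exists, not_and, not_lt] at hcon
  have h4 := hX.abs_le_of_abs_error_le hM hcon.2 (by positivity) hk.le
  have h5 : M₂ * (δ' * √n) / (1 - |θ₀|) = δ / 2 * √n := by simp only [δ']; field_simp
  linarith [hcon.1 k hk]

/-- Summing the recursion of `E X k²` gives `(1-θ₀²) ∑ E X k² = E X 0² - E X n² + ∑ τ t²`. The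
boundary terms are bounded, hence vanish after division by `n`. -/
theorem tendsto_sum_integral_sq_div [IsProbabilityMeasure P]
    (hX : IsHeteroscedasticAR1 P θ₀ τ ε X) {M₂ : ℝ} (hM : ∀ t, 1 ≤ t → τ t ≤ M₂) {v : ℝ}
    (hv : Tendsto (fun n : ℕ => (∑ t ∈ Finset.Icc 1 n, τ t ^ 2) / (n : ℝ)) atTop (𝓝 v)) :
    Tendsto (fun n : ℕ => (∑ k ∈ Finset.range n, (if k = 0 then 0 else 1) *
      ∫ ω, X k ω ^ 2 ∂P) / n) atTop (𝓝 (v / (1 - θ₀ ^ 2))) := by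
  have hθ : 0 < 1 - θ₀ ^ 2 := by linarith [hX.sq_lt_one]
  set m : ℕ → ℝ := fun k => ∫ ω, X k ω ^ 2 ∂P
  set B := m 0 + M₂ ^ 2 / (1 - θ₀ ^ 2)
  have hsum : ∀ n, (1 - θ₀ ^ 2) * ∑ k ∈ Finset.range n, m k =
      m 0 - m n + ∑ t ∈ Finset.Icc 1 n, τ t ^ 2 := by
    intro n
    rw [sum_Icc_one_eq_sum_range]
    induction n with
    | zero => simp
    | succ n ih =>
      rw [Finset.sum_range_succ, mul_add, ih, Finset.sum_range_succ,
        show m (n + 1) = _ from hX.integral_sq_succ n]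
      ring
  have hzero : ∀ n, 0 < n → ∑ k ∈ Finset.range n, (if k = 0 then 0 else 1) * m k =
      ∑ k ∈ Finset.range n, m k - m 0 := by
    intro n hn
    obtain ⟨n, rfl⟩ := Nat.exists_eq_succ_of_ne_zero hn.ne'
    rw [Finset.sum_range_succ', Finset.sum_range_succ']
    simp
  have hbd : Tendsto (fun n : ℕ => m n / n) atTop (𝓝 0) :=
    squeeze_zero (fun n => div_nonneg (integral_sq_nonneg X n) (Nat.cast_nonneg n))
      (fun n => div_le_div_of_nonneg_right (hX.integral_sq_le hM n) (Nat.cast_nonneg n))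
      (tendsto_const_div_atTop_nhds_zero_nat B)
  have h0 := tendsto_const_div_atTop_nhds_zero_nat (m 0)
  have hlim := (((h0.sub hbd).add hv).div_const (1 - θ₀ ^ 2)).sub h0
  rw [sub_zero, sub_zero, zero_add] at hlim
  refine hlim.congr' ?_
  filter_upwards [eventually_gt_atTop 0] with n hn
  rw [hzero n hn]
  have h1 : ∑ k ∈ Finset.range n, m k =
      (m 0 - m n + ∑ t ∈ Finset.Icc 1 n, τ t ^ 2) / (1 - θ₀ ^ 2) := by
    rw [eq_div_iff hθ.ne', mul_comm, hsum]
  rw [h1]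
  have hn' : (n : ℝ) ≠ 0 := by positivity
  field_simp

end IsHeteroscedasticAR1

/-! ### The normalized score and the estimator -/

/-- The weights `τₖ₊₁²` of `Xₖ²` in the conditional variance of the score; the sums in the
estimator start from `X₁`, so that the weight of `X₀²` is zero. -/
def scoreWeight (τ : ℕ → ℝ) (k : ℕ) : ℝ := if k = 0 then 0 else τ (k + 1) ^ 2

/-- The score `∑_{t=2}^n Xₜ₋₁ Zₜ` divided by `sₙ` is `∑_{k < n} aₙₖ εₖ₊₁` with these
multipliers `aₙₖ`. -/
noncomputable def scoreMultiplier {Ω : Type*} [MeasurableSpace Ω] (P : Measure Ω) (τ : ℕ → ℝ)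
    (X : ℕ → Ω → ℝ) (n k : ℕ) (ω : Ω) : ℝ :=
  (if k = 0 then 0 else τ (k + 1) * X k ω) / scoreScale P τ X n

theorem tendstoNormal_of_tendstoInDistribution_mul {Ω : Type*} [MeasurableSpace Ω] {P : Measure Ω}
    [IsProbabilityMeasure P] {Y : ℕ → Ω → ℝ} {b v : ℝ}
    (h : TendstoInDistribution Y atTop (fun x : ℝ => b * x) (fun _ => P) (gaussianReal 0 1))
    (hv : v = b ^ 2) : TendstoNormal P Y v := by
  have hmap : (gaussianReal 0 v.toNNReal).map id = (gaussianReal 0 1).map fun x : ℝ => b * x := by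
    rw [gaussianReal_map_const_mul, Measure.map_id, mul_zero, mul_one, hv]
    congr 1
    ext
    simp [Real.coe_toNNReal _ (sq_nonneg b)]
  refine ⟨h.forall_aemeasurable, aemeasurable_id, ?_⟩
  convert! h.tendsto using 2
  exact congrArg 𝓝 (Subtype.ext hmap)

namespace IsHeteroscedasticAR1

variable {Ω : Type*} {mΩ : MeasurableSpace Ω} {P : Measure Ω} {θ₀ : ℝ} {τ : ℕ → ℝ}
  {ε X : ℕ → Ω → ℝ}

theorem scoreScale_eq (P : Measure Ω) (τ : ℕ → ℝ) (X : ℕ → Ω → ℝ) (n : ℕ) : scoreScale P τ X n =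
    √(∑ k ∈ Finset.range n, scoreWeight τ k * ∫ ω, X k ω ^ 2 ∂P) := by
  rw [scoreScale, sum_Icc_two_eq_sum_range]
  congr 1
  refine Finset.sum_congr rfl fun k _ => ?_
  simp only [scoreWeight, ite_mul, zero_mul, Nat.add_sub_cancel]

theorem scoreScale_sq (P : Measure Ω) (τ : ℕ → ℝ) (X : ℕ → Ω → ℝ) (n : ℕ) :
    scoreScale P τ X n ^ 2 = ∑ k ∈ Finset.range n, scoreWeight τ k * ∫ ω, X k ω ^ 2 ∂P := by
  rw [scoreScale_eq, Real.sq_sqrt]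
  refine Finset.sum_nonneg fun k _ => mul_nonneg ?_ (integral_sq_nonneg X k)
  unfold scoreWeight
  split_ifs
  · exact le_rfl
  · exact sq_nonneg _

/-- For `k ≥ 1` both `τ (k+1)²` and `E X k² ≥ τ k²` are at least `M₁²`. There are `n - 1` such
terms, and `n - 1 ≥ n/2` once `n ≥ 2`. -/
theorem le_scoreScale_sq [IsProbabilityMeasure P] (hX : IsHeteroscedasticAR1 P θ₀ τ ε X) {M₁ : ℝ}
    (hM₁ : 0 < M₁) (hM : ∀ t, 1 ≤ t → M₁ ≤ τ t) {n : ℕ} (hn : 2 ≤ n) :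
    M₁ ^ 4 / 2 * n ≤ scoreScale P τ X n ^ 2 := by
  have key : ∀ n : ℕ, M₁ ^ 4 * ((n : ℝ) - 1) ≤ scoreScale P τ X n ^ 2 := by
    intro n
    rw [scoreScale_sq]
    induction n with
    | zero => simp; positivity
    | succ n ih =>
      rw [Finset.sum_range_succ]
      rcases Nat.eq_zero_or_pos n with rfl | hn
      · simp [scoreWeight]
      · obtain ⟨k, rfl⟩ := Nat.exists_eq_succ_of_ne_zero hn.ne'
        have h1 : M₁ ^ 2 ≤ τ (k + 1 + 1) ^ 2 := pow_le_pow_left₀ hM₁.le (hM _ (by omega)) 2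
        have h2 : M₁ ^ 2 ≤ ∫ ω, X (k + 1) ω ^ 2 ∂P := by
          rw [hX.integral_sq_succ]
          have := pow_le_pow_left₀ hM₁.le (hM (k + 1) (by omega)) 2
          nlinarith [mul_nonneg (sq_nonneg θ₀) (integral_sq_nonneg (P := P) X k)]
        have h3 : M₁ ^ 2 * M₁ ^ 2 ≤ scoreWeight τ (k + 1) * ∫ ω, X (k + 1) ω ^ 2 ∂P := by
          rw [scoreWeight, if_neg (by omega)]
          exact mul_le_mul h1 h2 (sq_nonneg _) (sq_nonneg _)
        push_cast at ih ⊢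
        simp only [Nat.succ_eq_add_one]
        linarith
  have hn' : (2 : ℝ) ≤ n := by exact_mod_cast hn
  nlinarith [key n, pow_pos hM₁ 4]

theorem scoreScale_pos [IsProbabilityMeasure P] (hX : IsHeteroscedasticAR1 P θ₀ τ ε X) {M₁ : ℝ}
    (hM₁ : 0 < M₁) (hM : ∀ t, 1 ≤ t → M₁ ≤ τ t) {n : ℕ} (hn : 2 ≤ n) : 0 < scoreScale P τ X n := by
  have h1 := hX.le_scoreScale_sq hM₁ hM hn
  have h2 : 0 < M₁ ^ 4 / 2 * n := by positivity
  refine (Real.sqrt_nonneg _).lt_of_ne' fun h => ?_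
  change scoreScale P τ X n = 0 at h
  rw [h] at h1
  linarith

theorem sqrt_mul_le_scoreScale [IsProbabilityMeasure P] (hX : IsHeteroscedasticAR1 P θ₀ τ ε X)
    {M₁ : ℝ} (hM₁ : 0 < M₁) (hM : ∀ t, 1 ≤ t → M₁ ≤ τ t) {n : ℕ} (hn : 2 ≤ n) :
    √(M₁ ^ 4 / 2) * √n ≤ scoreScale P τ X n := by
  rw [← Real.sqrt_mul (by positivity)]
  exact Real.sqrt_le_iff.2 ⟨Real.sqrt_nonneg _, hX.le_scoreScale_sq hM₁ hM hn⟩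

theorem abs_scoreWeight_le (hX : IsHeteroscedasticAR1 P θ₀ τ ε X) {M₂ : ℝ}
    (hM : ∀ t, 1 ≤ t → τ t ≤ M₂) (k : ℕ) : |scoreWeight τ k| ≤ M₂ ^ 2 := by
  unfold scoreWeight
  split_ifs
  · simpa using sq_nonneg M₂
  · rw [abs_pow]
    exact pow_le_pow_left₀ (abs_nonneg _) (hX.abs_scale_le hM k) 2

/-- By the definition of `sₙ²`, the deviation from `1` is the weighted sum of `X k² - E X k²` over
`sₙ²`. The weak law makes the numerator `o(n)` in probability, and `sₙ²` grows at least linearly. -/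
theorem tendstoInMeasure_sum_scoreMultiplier_sq [IsProbabilityMeasure P]
    (hX : IsHeteroscedasticAR1 P θ₀ τ ε X) {M₁ M₂ : ℝ} (hM₁ : 0 < M₁)
    (hA1 : ∀ t, 1 ≤ t → M₁ ≤ τ t ∧ τ t ≤ M₂) :
    TendstoInMeasure P (fun n ω => ∑ k ∈ Finset.range n, scoreMultiplier P τ X n k ω ^ 2) atTop
      (fun _ => 1) := by
  rw [tendstoInMeasure_iff_measureReal_norm]
  intro δ hδ
  have h := hX.tendsto_integral_abs_sum_sq_sub_div (fun t ht => (hA1 t ht).2)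
    (hX.abs_scoreWeight_le fun t ht => (hA1 t ht).2)
  refine tendsto_measureReal_of_eventually_subset (tendsto_measureReal_mul_le_abs
    (hX.integrable_sum_sq_sub (scoreWeight τ)) h
    (show 0 < δ * (M₁ ^ 4 / 2) by positivity)) ?_
  filter_upwards [eventually_ge_atTop 2] with n hn ω hω
  simp only [Set.mem_ofPred_eq, Real.norm_eq_abs] at hω ⊢
  have hs := hX.scoreScale_pos hM₁ (fun t ht => (hA1 t ht).1) hn
  have hs2 : 0 < scoreScale P τ X n ^ 2 := by positivity
  have heq : ∑ k ∈ Finset.range n, scoreMultiplier P τ X n k ω ^ 2 - 1 =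
      (∑ k ∈ Finset.range n, scoreWeight τ k * (X k ω ^ 2 - ∫ ω', X k ω' ^ 2 ∂P)) /
        scoreScale P τ X n ^ 2 := by
    rw [eq_div_iff hs2.ne', sub_mul, one_mul]
    rw [Finset.sum_mul]
    simp_rw [mul_sub]
    rw [Finset.sum_sub_distrib, ← scoreScale_sq P τ X n]
    congr 1
    refine Finset.sum_congr rfl fun k _ => ?_
    rw [scoreMultiplier, div_pow, div_mul_cancel₀ _ hs2.ne', scoreWeight]
    split_ifs <;> ring
  rw [heq, abs_div, abs_of_pos hs2, le_div_iff₀ hs2] at hω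
  have := hX.le_scoreScale_sq hM₁ (fun t ht => (hA1 t ht).1) hn
  nlinarith

theorem tendsto_measureReal_exists_lt_abs_scoreMultiplier [IsProbabilityMeasure P]
    (hX : IsHeteroscedasticAR1 P θ₀ τ ε X) {M₁ M₂ : ℝ} (hM₁ : 0 < M₁)
    (hA1 : ∀ t, 1 ≤ t → M₁ ≤ τ t ∧ τ t ≤ M₂) {δ : ℝ} (hδ : 0 < δ) :
    Tendsto (fun n => P.real {ω | ∃ k < n, δ < |scoreMultiplier P τ X n k ω|}) atTop (𝓝 0) := by
  have hM₂ : 0 < M₂ := hM₁.trans_le ((hA1 1 le_rfl).1.trans (hA1 1 le_rfl).2)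
  refine tendsto_measureReal_of_eventually_subset (hX.tendsto_measureReal_exists_lt_abs hM₂
    (fun t ht => (hA1 t ht).2) (show 0 < δ * √(M₁ ^ 4 / 2) / M₂ by positivity)) ?_
  filter_upwards [eventually_ge_atTop 2] with n hn
  rintro ω ⟨k, hk, hlt⟩
  refine ⟨k, hk, ?_⟩
  have hs := hX.scoreScale_pos hM₁ (fun t ht => (hA1 t ht).1) hn
  have hle := hX.sqrt_mul_le_scoreScale hM₁ (fun t ht => (hA1 t ht).1) hn
  rw [scoreMultiplier, abs_div, abs_of_pos hs, lt_div_iff₀ hs] at hlt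
  have h1 : |if k = 0 then 0 else τ (k + 1) * X k ω| ≤ M₂ * |X k ω| := by
    split_ifs
    · rw [abs_zero]; positivity
    · rw [abs_mul]
      exact mul_le_mul_of_nonneg_right (hX.abs_scale_le (fun t ht => (hA1 t ht).2) k)
        (abs_nonneg _)
  rw [div_mul_eq_mul_div, div_lt_iff₀ hM₂]
  nlinarith

theorem measurable_scoreMultiplier (hX : IsHeteroscedasticAR1 P θ₀ τ ε X) (n k : ℕ) :
    Measurable[hX.filtration k] (scoreMultiplier P τ X n k) := by
  unfold scoreMultiplier
  split_ifs
  · exact measurable_const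
  · exact ((hX.measurable_filtration k).const_mul _).div_const _

theorem tendstoInDistribution_normalized_score [IsProbabilityMeasure P]
    (hX : IsHeteroscedasticAR1 P θ₀ τ ε X) {M₁ M₂ : ℝ} (hM₁ : 0 < M₁)
    (hA1 : ∀ t, 1 ≤ t → M₁ ≤ τ t ∧ τ t ≤ M₂) :
    TendstoInDistribution
      (fun n ω => ∑ k ∈ Finset.range n, scoreMultiplier P τ X n k ω * ε (k + 1) ω) atTop
      (id : ℝ → ℝ) (fun _ => P) (gaussianReal 0 1) :=
  tendstoInDistribution_sum_predictable_mul (ℱ := hX.filtration) (e := fun k => ε (k + 1))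
    hX.measurable_error_filtration hX.indep_filtration hX.map_error_eq
    (hX.mean_error _ (by omega)) (hX.integral_error_sq 0)
    (fun n k _ => hX.measurable_scoreMultiplier n k)
    (hX.tendstoInMeasure_sum_scoreMultiplier_sq hM₁ hA1)
    (fun _ hδ => hX.tendsto_measureReal_exists_lt_abs_scoreMultiplier hM₁ hA1 hδ)

theorem tendstoInMeasure_sum_sq_div [IsProbabilityMeasure P]
    (hX : IsHeteroscedasticAR1 P θ₀ τ ε X) {M₂ : ℝ} (hM : ∀ t, 1 ≤ t → τ t ≤ M₂) {v : ℝ}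
    (hv : Tendsto (fun n : ℕ => (∑ t ∈ Finset.Icc 1 n, τ t ^ 2) / (n : ℝ)) atTop (𝓝 v)) :
    TendstoInMeasure P (fun (n : ℕ) ω => (∑ t ∈ Finset.Icc 2 n, X (t - 1) ω ^ 2) / n) atTop
      (fun _ => v / (1 - θ₀ ^ 2)) := by
  rw [tendstoInMeasure_iff_measureReal_norm]
  intro δ hδ
  set w : ℕ → ℝ := fun k => if k = 0 then 0 else 1
  have hw : ∀ k, |w k| ≤ 1 := fun k => by simp only [w]; split_ifs <;> simp
  have h := hX.tendsto_integral_abs_sum_sq_sub_div hM hw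
  refine tendsto_measureReal_of_eventually_subset (tendsto_measureReal_mul_le_abs
    (hX.integrable_sum_sq_sub w) h (half_pos hδ)) ?_
  have hmean := Metric.tendsto_nhds.1 (hX.tendsto_sum_integral_sq_div hM hv) _ (half_pos hδ)
  filter_upwards [hmean, eventually_gt_atTop 0] with n hn hn0 ω hω
  have hn' : (0 : ℝ) < n := Nat.cast_pos.2 hn0
  simp only [Set.mem_ofPred_eq, Real.norm_eq_abs, Real.dist_eq] at hω hn ⊢
  rw [sum_Icc_two_eq_sum_range (fun t => X (t - 1) ω ^ 2)] at hω
  have heq : (∑ k ∈ Finset.range n, if k = 0 then 0 else X (k + 1 - 1) ω ^ 2) / (n : ℝ) =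
      (∑ k ∈ Finset.range n, w k * (X k ω ^ 2 - ∫ ω', X k ω' ^ 2 ∂P)) / n +
      (∑ k ∈ Finset.range n, w k * ∫ ω', X k ω' ^ 2 ∂P) / n := by
    rw [← add_div, ← Finset.sum_add_distrib]
    congr 1
    refine Finset.sum_congr rfl fun k _ => ?_
    simp only [w, Nat.add_sub_cancel]
    split_ifs <;> ring
  rw [heq, add_sub_assoc] at hω
  have h1 := hω.trans (abs_add_le _ _)
  have h2 : δ / 2 ≤ |(∑ k ∈ Finset.range n, w k * (X k ω ^ 2 - ∫ ω', X k ω' ^ 2 ∂P)) / (n : ℝ)| := by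
    linarith
  rwa [abs_div, abs_of_pos hn', le_div_iff₀ hn'] at h2

theorem measurable_olsEstimator (hX : IsHeteroscedasticAR1 P θ₀ τ ε X) (n : ℕ) :
    Measurable (olsEstimator X n) :=
  (Finset.measurable_fun_sum _ fun t _ => (hX.measurable t).mul (hX.measurable (t - 1))).div
    (Finset.measurable_fun_sum _ fun t _ => (hX.measurable (t - 1)).pow_const 2)

theorem sum_mul_eq_score (hX : IsHeteroscedasticAR1 P θ₀ τ ε X) {n : ℕ}
    (hs : scoreScale P τ X n ≠ 0) (ω : Ω) :
    ∑ t ∈ Finset.Icc 2 n, X t ω * X (t - 1) ω = θ₀ * ∑ t ∈ Finset.Icc 2 n, X (t - 1) ω ^ 2 +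
      scoreScale P τ X n * ∑ k ∈ Finset.range n, scoreMultiplier P τ X n k ω * ε (k + 1) ω := by
  rw [sum_Icc_two_eq_sum_range (fun t => X t ω * X (t - 1) ω),
    sum_Icc_two_eq_sum_range (fun t => X (t - 1) ω ^ 2), Finset.mul_sum, Finset.mul_sum,
    ← Finset.sum_add_distrib]
  refine Finset.sum_congr rfl fun k _ => ?_
  simp only [Nat.add_sub_cancel, scoreMultiplier]
  split_ifs
  · simp
  · rw [hX.succ_eq]; field_simp

theorem tendstoInDistribution_olsEstimator [IsProbabilityMeasure P]
    (hX : IsHeteroscedasticAR1 P θ₀ τ ε X) {M₁ M₂ : ℝ} (hM₁ : 0 < M₁)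
    (hA1 : ∀ t, 1 ≤ t → M₁ ≤ τ t ∧ τ t ≤ M₂) {v : ℝ} (hv0 : 0 < v)
    (hv : Tendsto (fun n : ℕ => (∑ t ∈ Finset.Icc 1 n, τ t ^ 2) / (n : ℝ)) atTop (𝓝 v)) :
    TendstoInDistribution
      (fun n ω => (scoreScale P τ X n / √(n : ℝ))⁻¹ * (√(n : ℝ) * (olsEstimator X n ω - θ₀))) atTop
      (fun x : ℝ => (1 - θ₀ ^ 2) / v * x) (fun _ => P) (gaussianReal 0 1) := by
  have hθ : 0 < 1 - θ₀ ^ 2 := by linarith [hX.sq_lt_one]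
  set d := v / (1 - θ₀ ^ 2)
  have hd : 0 < d := by positivity
  have hZ := hX.tendstoInMeasure_sum_sq_div (fun t ht => (hA1 t ht).2) hv
  have hZm : ∀ n : ℕ, AEMeasurable (fun ω => (∑ t ∈ Finset.Icc 2 n, X (t - 1) ω ^ 2) / (n : ℝ)) P :=
    fun n => ((Finset.measurable_fun_sum _ fun t _ =>
      (hX.measurable (t - 1)).pow_const 2).div_const _).aemeasurable
  -- Division is not continuous at zero, so the denominator is cut off at half its limit `d`. This
  -- changes nothing on an event whose probability tends to `1`.
  have hg : Continuous fun p : ℝ × ℝ => p.1 / max p.2 (d / 2) :=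
    continuous_fst.div (by fun_prop) fun p => (lt_max_of_lt_right (half_pos hd)).ne'
  have hG := (hX.tendstoInDistribution_normalized_score hM₁
    hA1).continuous_comp_prodMk_of_tendstoInMeasure_const hg hZ hZm
  have hlim : (fun x : ℝ => (1 - θ₀ ^ 2) / v * x) = fun x : ℝ => id x / max d (d / 2) := by
    ext x
    rw [max_eq_left (by linarith)]
    simp only [id, d]; field_simp
  rw [hlim]
  refine tendstoInDistribution_of_tendstoInMeasure_sub _ _ hG ?_ fun n =>
    (((hX.measurable_olsEstimator n).sub_const _).const_mul _).const_mul _ |>.aemeasurable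
  rw [tendstoInMeasure_iff_measureReal_norm] at hZ ⊢
  intro δ hδ
  refine tendsto_measureReal_of_eventually_subset (hZ (d / 2) (half_pos hd)) ?_
  filter_upwards [eventually_ge_atTop 2] with n hn ω hω
  simp only [Set.mem_ofPred_eq, Pi.sub_apply, Pi.zero_apply, sub_zero] at hω ⊢
  by_contra hcon
  rw [not_le, Real.norm_eq_abs] at hcon
  have hZge : d / 2 < (∑ t ∈ Finset.Icc 2 n, X (t - 1) ω ^ 2) / (n : ℝ) := by
    linarith [(abs_lt.1 hcon).1]
  have hs := hX.scoreScale_pos hM₁ (fun t ht => (hA1 t ht).1) hn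
  have hn' : (0 : ℝ) < n := by positivity
  have hD : 0 < ∑ t ∈ Finset.Icc 2 n, X (t - 1) ω ^ 2 :=
    (div_pos_iff_of_pos_right hn').1 ((half_pos hd).trans hZge)
  rw [max_eq_left hZge.le, olsEstimator, hX.sum_mul_eq_score hs.ne'] at hω
  set Y := ∑ k ∈ Finset.range n, scoreMultiplier P τ X n k ω * ε (k + 1) ω
  set S := ∑ t ∈ Finset.Icc 2 n, X (t - 1) ω ^ 2
  set s := scoreScale P τ X n
  -- On the good event the normalized estimator is exactly the score over the averaged denominator;
  -- this needs `s ≠ 0`, hence `n ≥ 2`.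
  have hzero : (s / √(n : ℝ))⁻¹ * (√(n : ℝ) * ((θ₀ * S + s * Y) / S - θ₀)) - Y / (S / n) = 0 := by
    have h1 : (θ₀ * S + s * Y) / S - θ₀ = s * Y / S := by field_simp; ring
    have h2 : √(n : ℝ) * √n = n := Real.mul_self_sqrt hn'.le
    rw [h1, inv_div]
    have h3 : √(n : ℝ) / s * (√n * (s * Y / S)) = (√n * √n) * Y / S := by field_simp
    rw [h3, h2, sub_eq_zero]; field_simp
  rw [hzero, norm_zero] at hω
  linarith

/-- The second-moment recursion unrolled. The factor `θ₀²` turns the exponents into `2(j - i)` with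
`j = k + 1`, the form occurring in (A3). -/
theorem integral_sq_eq [IsProbabilityMeasure P] (hX : IsHeteroscedasticAR1 P θ₀ τ ε X) (k : ℕ) :
    θ₀ ^ 2 * ∫ ω, X k ω ^ 2 ∂P = θ₀ ^ (2 * (k + 1)) * ∫ ω, X 0 ω ^ 2 ∂P +
      ∑ i ∈ Finset.Ico 1 (k + 1), τ i ^ 2 * θ₀ ^ (2 * (k + 1 - i)) := by
  induction k with
  | zero => simp
  | succ k ih =>
    rw [hX.integral_sq_succ, mul_add, ih, Finset.sum_Ico_succ_top (by omega : 1 ≤ k + 1), mul_add,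
      Finset.mul_sum]
    have h : ∀ i ∈ Finset.Ico 1 (k + 1), θ₀ ^ 2 * (τ i ^ 2 * θ₀ ^ (2 * (k + 1 - i))) =
        τ i ^ 2 * θ₀ ^ (2 * (k + 1 + 1 - i)) := fun i hi => by
      have hi := (Finset.mem_Ico.1 hi).2
      rw [show 2 * (k + 1 + 1 - i) = 2 * (k + 1 - i) + 2 by omega, pow_add]; ring
    rw [Finset.sum_congr rfl h, show 2 * (k + 1 + 1 - (k + 1)) = 2 by omega]
    ring

theorem tendsto_scoreScale_sq_div [IsProbabilityMeasure P]
    (hX : IsHeteroscedasticAR1 P θ₀ τ ε X) {M₂ : ℝ} (hM : ∀ t, 1 ≤ t → τ t ≤ M₂) (hθ₀ : θ₀ ≠ 0)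
    {r : ℝ} (hr : Tendsto (fun n : ℕ => (1 / (n : ℝ)) * ∑ j ∈ Finset.Icc 1 n,
      ∑ i ∈ Finset.Ico 1 j, τ i ^ 2 * τ j ^ 2 * θ₀ ^ (2 * (j - i))) atTop (𝓝 r)) :
    Tendsto (fun n : ℕ => scoreScale P τ X n ^ 2 / n) atTop (𝓝 (r / θ₀ ^ 2)) := by
  set m₀ := ∫ ω, X 0 ω ^ 2 ∂P
  have hm₀ : 0 ≤ m₀ := integral_sq_nonneg X 0
  -- The contribution of the initial value to `θ₀² sₙ²`, bounded in `n` by a geometric series.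
  set R : ℕ → ℝ := fun n => ∑ k ∈ Finset.range n, scoreWeight τ k * (θ₀ ^ 2) ^ (k + 1) * m₀
  have hw : ∀ k, 0 ≤ scoreWeight τ k ∧ scoreWeight τ k ≤ M₂ ^ 2 := fun k => by
    refine ⟨?_, (le_abs_self _).trans (hX.abs_scoreWeight_le hM k)⟩
    unfold scoreWeight; split_ifs
    · exact le_rfl
    · exact sq_nonneg _
  have hR0 : ∀ n, 0 ≤ R n := fun n => Finset.sum_nonneg fun k _ =>
    mul_nonneg (mul_nonneg (hw k).1 (by positivity)) hm₀
  have hRle : ∀ n, R n ≤ M₂ ^ 2 * m₀ * (1 - θ₀ ^ 2)⁻¹ := fun n => by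
    have hs := summable_geometric_of_lt_one (sq_nonneg θ₀) hX.sq_lt_one
    rw [← tsum_geometric_of_lt_one (sq_nonneg θ₀) hX.sq_lt_one]
    calc R n ≤ ∑ k ∈ Finset.range n, M₂ ^ 2 * m₀ * (θ₀ ^ 2) ^ k := by
          refine Finset.sum_le_sum fun k _ => ?_
          have h1 : (θ₀ ^ 2) ^ (k + 1) ≤ (θ₀ ^ 2) ^ k :=
            pow_le_pow_of_le_one (sq_nonneg _) hX.sq_lt_one.le k.le_succ
          have h2 : scoreWeight τ k * (θ₀ ^ 2) ^ (k + 1) ≤ M₂ ^ 2 * (θ₀ ^ 2) ^ k :=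
            mul_le_mul (hw k).2 h1 (by positivity) (sq_nonneg _)
          nlinarith [mul_le_mul_of_nonneg_right h2 hm₀]
      _ ≤ _ := by
          rw [← Finset.mul_sum]
          exact mul_le_mul_of_nonneg_left (hs.sum_le_tsum _ fun k _ => by positivity)
            (by positivity)
  have hRlim : Tendsto (fun n : ℕ => R n / n) atTop (𝓝 0) :=
    squeeze_zero (fun n => div_nonneg (hR0 n) (Nat.cast_nonneg n))
      (fun n => div_le_div_of_nonneg_right (hRle n) (Nat.cast_nonneg n))
      (tendsto_const_div_atTop_nhds_zero_nat _)
  have heq : ∀ n : ℕ, θ₀ ^ 2 * scoreScale P τ X n ^ 2 = R n + ∑ j ∈ Finset.Icc 1 n,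
      ∑ i ∈ Finset.Ico 1 j, τ i ^ 2 * τ j ^ 2 * θ₀ ^ (2 * (j - i)) := by
    intro n
    rw [scoreScale_sq, sum_Icc_one_eq_sum_range, Finset.mul_sum, ← Finset.sum_add_distrib]
    refine Finset.sum_congr rfl fun k _ => ?_
    -- At `k = 0` the zero weight of `X 0²` matches the empty inner sum for `j = 1`.
    rcases Nat.eq_zero_or_pos k with rfl | hk
    · simp [scoreWeight]
    · rw [mul_left_comm, hX.integral_sq_eq, scoreWeight, if_neg hk.ne', mul_add, Finset.mul_sum,
        pow_mul, mul_assoc]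
      congr 1
      exact Finset.sum_congr rfl fun i _ => by ring
  have hlim := (hRlim.add hr).div_const (θ₀ ^ 2)
  rw [zero_add] at hlim
  refine hlim.congr fun n => ?_
  rw [one_div, inv_mul_eq_div, ← add_div, ← heq]
  field_simp

end IsHeteroscedasticAR1

/-! ### The two limit theorems -/

theorem theorem5 {Ω : Type*} [MeasurableSpace Ω] (P : Measure Ω) [IsProbabilityMeasure P]
    (θ₀ : ℝ) (τ : ℕ → ℝ) (ε X : ℕ → Ω → ℝ) (hX : IsHeteroscedasticAR1 P θ₀ τ ε X)
    (M₁ M₂ τlim : ℝ) (hM₁ : 0 < M₁)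
    (hA1 : ∀ t, 1 ≤ t → M₁ ≤ τ t ∧ τ t ≤ M₂)
    (hτlim : 0 < τlim ^ 2)
    (hA2 : Tendsto (fun n : ℕ => (∑ t ∈ Finset.Icc 1 n, τ t ^ 2) / (n : ℝ)) atTop
      (𝓝 (τlim ^ 2))) :
    TendstoNormal P
        (fun n ω => (scoreScale P τ X n / √(n : ℝ))⁻¹ * (√(n : ℝ) * (olsEstimator X n ω - θ₀)))
        ((1 - θ₀ ^ 2) ^ 2 / τlim ^ 4) ∧
      ∀ ρ : ℝ, θ₀ ≠ 0 →
        Tendsto (fun n : ℕ => (1 / (n : ℝ)) * ∑ j ∈ Finset.Icc 1 n, ∑ i ∈ Finset.Ico 1 j,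
          τ i ^ 2 * τ j ^ 2 * θ₀ ^ (2 * (j - i))) atTop (𝓝 (ρ ^ 2)) →
        TendstoNormal P (fun n ω => √(n : ℝ) * (olsEstimator X n ω - θ₀))
          (ρ ^ 2 * (1 - θ₀ ^ 2) ^ 2 / (τlim ^ 4 * θ₀ ^ 2)) := by
  have hmain := hX.tendstoInDistribution_olsEstimator hM₁ hA1 hτlim hA2
  refine ⟨tendstoNormal_of_tendstoInDistribution_mul hmain (by ring), fun ρ hθ₀ hA3 => ?_⟩
  -- The limit of `sₙ/√n`, which is nonnegative although `ρ` and `θ₀` may have either sign.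
  set r := √(ρ ^ 2 / θ₀ ^ 2)
  have hr : r ^ 2 = ρ ^ 2 / θ₀ ^ 2 := Real.sq_sqrt (by positivity)
  have hscale : Tendsto (fun n : ℕ => scoreScale P τ X n / √(n : ℝ)) atTop (𝓝 r) := by
    refine (Real.continuous_sqrt.tendsto _).comp (hX.tendsto_scoreScale_sq_div
      (fun t ht => (hA1 t ht).2) hθ₀ hA3) |>.congr fun n => ?_
    rw [Function.comp_apply, Real.sqrt_div (sq_nonneg _),
      Real.sqrt_sq (show 0 ≤ scoreScale P τ X n from Real.sqrt_nonneg _)]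
  -- Slutsky again, with the deterministic factor `sₙ/√n`. It cancels its own inverse as soon as `sₙ
  -- > 0`, so the product equals `√n (θ̂₂ - θ₀)` for `n ≥ 2`.
  have hG := hmain.continuous_comp_prodMk_of_tendstoInMeasure_const
    (g := fun p : ℝ × ℝ => p.2 * p.1) (by fun_prop)
    (tendstoInMeasure_of_tendsto_ae (μ := P) (f := fun (n : ℕ) _ => scoreScale P τ X n / √(n : ℝ))
      (fun _ => aestronglyMeasurable_const) (ae_of_all _ fun _ => hscale))
    fun _ => aemeasurable_const
  have hH := tendstoInDistribution_of_tendstoInMeasure_sub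
    (fun (n : ℕ) ω => √(n : ℝ) * (olsEstimator X n ω - θ₀)) _ hG ?_ fun n =>
      (((hX.measurable_olsEstimator n).sub_const _).const_mul _).aemeasurable
  · refine tendstoNormal_of_tendstoInDistribution_mul (b := r * ((1 - θ₀ ^ 2) / τlim ^ 2)) ?_ ?_
    · simpa only [mul_assoc] using hH
    · rw [mul_pow, hr]; field_simp
  · rw [tendstoInMeasure_iff_measureReal_norm]
    intro δ hδ
    refine tendsto_const_nhds.congr' ?_
    filter_upwards [eventually_ge_atTop 2] with n hn
    have hs := hX.scoreScale_pos hM₁ (fun t ht => (hA1 t ht).1) hn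
    have hn' : (0 : ℝ) < n := by positivity
    have hne : scoreScale P τ X n / √(n : ℝ) ≠ 0 := by positivity
    simp only [Pi.sub_apply, Pi.zero_apply, mul_inv_cancel_left₀ hne, sub_self, norm_zero]
    simp [not_le.2 hδ]
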